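/- Let $D\subset\mathbb{R}^d$ ($d\ge 1$) be compact and convex, and for $t=1,2,\dots$ let $f_t:D\to\mathbb{R}$ be convex and Lipschitz with constant $K_t$, where $K=\sup_{t\ge1}K_t<\infty$. Write $f_t^*=\min_D f_t$, $C_t(c)=\{x\in D: f_t(x)-f_t^*\le c\}$ and $L_t(c)=\{x\in D: f_t(x)-f_t^*=c\}$. Let $\epsilon>0$ and $a\in(0,1]$. Let $\mathcal P\subset D$ be a set of $n$ points which is a $\delta$-uniform grid of $D$ with $0<\delta<\frac{2\epsilon}{7\sqrt d\,K}$; that is, for every $x\in\mathcal P$ and every standard basis vector $e_j$ those of the points $x\pm\delta e_j$ that lie in $D$ belong to $\mathcal P$, and every point of $D$ is within distance $\sqrt d\,\delta/2$ of $\mathcal P$. At each round $t\ge1$ one observes $\widetilde f_t(x)=f_t(x)+N_t(x)$ for all $x\in\mathcal P$, where the $N_t(x)$ ($t\ge 1$, $x\in\mathcal P$) are i.i.d. bounded random variables with mean zero and $\sup N_t(x)-\inf N_t(x)<L_N$ for a constant $L_N>0$. For an integer $T\ge1$ define estimates on $\mathcal P$ by $$\widehat f_t(x)=\frac{\min\{t,T+1\}-1}{\min\{t,T\}}\widehat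 f_{t-1}(x)+\frac{1}{\min\{t,T\}}\widetilde f_t(x)-\frac1T\widetilde f_{t-T}(x)\mathbf 1\{t>T\},\qquad t\ge1,$$ and let $\widehat x_t^*$ be any minimizer of $\widehat f_t$ over $\mathcal P$. The hitting time $T(\epsilon,a)$ is the least integer $T\ge 1$ such that, for the estimates built with this $T$, $\mathbb{P}\big(|f_t(\widehat x_t^*)-f_t^*|\le\epsilon\big)\ge 1-a$ for all $t\ge T$ (where the event requires the inequality for every minimizer $\widehat x_t^*$). Suppose that $|f_{t+1}(x)-f_t(x)|\le \frac{\epsilon^3}{43L_N^2\ln(n/a)}$ for all $t\ge1$ and $x\in D$; that there is $M>0$ such that for every $t\ge1$ the level set $L_t(M)\subset D$ is homeomorphic to the unit sphere of $\mathbb{R}^d$ (two points if $d=1$, a circle if $d=2$); and that there is $k>0$ such that for every $t\ge1$ the function $f_t$ is differentiable with $\|\nabla f_t(x)\|\ge k$ at all interior points $x$ of $D$ outside $C_t(\epsilon)$. Let $l_m\ge0$ be an integer with $l_m\le\lfloor M/\epsilon\rfloor-3$ and $M\ne(l+4)\epsilon$ for all $l\in\{0,\dots,l_m-1\}$, and put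 $$n_l=\frac{m_l}{1+m_l}\,n+1,\qquad m_l=\frac{2^{d+1}K\epsilon}{k\,(M-(l+4)\epsilon)}\qquad (0\le l\le l_m-1),\qquad n_{l_m}=n-\sum_{l=0}^{l_m-1}n_l.$$ Then for all $t\ge1$ and $0\le l\le l_m-1$ the number of grid points $x\in\mathcal P$ with $(l+1)\epsilon<f_t(x)-f_t^*\le(l+2)\epsilon$ is at most $n_l$. Moreover the hitting time $T(\epsilon,a)$ exists, integers $T\ge1$ with $$\sum_{l=0}^{l_m}n_l\exp\Big(-\frac{2T(l+\frac27)^2\epsilon^2}{L_N^2}\Big)\le a$$ exist, and $T(\epsilon,a)$ is at most the least such $T$. -/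

import Mathlib

open scoped NNReal

noncomputable section

/-- The minimum value `f(x*)` of `f` over the domain `D` (attained when `D` is compact and nonempty
and `f` is continuous on `D`). -/
def minValue {d : ℕ} (D : Set (EuclideanSpace ℝ (Fin d))) (f : EuclideanSpace ℝ (Fin d) → ℝ) : ℝ :=
  sInf (f '' D)

/-- The lower contour set `C(c) = {x ∈ D : f(x) - f(x*) ≤ c}`. -/
def lowerContour {d : ℕ} (D : Set (EuclideanSpace ℝ (Fin d)))
    (f : EuclideanSpace ℝ (Fin d) → ℝ) (c : ℝ) : Set (EuclideanSpace ℝ (Fin d)) :=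
  {x | x ∈ D ∧ f x - minValue D f ≤ c}

/-- The level set `L(c) = {x ∈ D : f(x) - f(x*) = c}`. -/
def levelSet {d : ℕ} (D : Set (EuclideanSpace ℝ (Fin d)))
    (f : EuclideanSpace ℝ (Fin d) → ℝ) (c : ℝ) : Set (EuclideanSpace ℝ (Fin d)) :=
  {x | x ∈ D ∧ f x - minValue D f = c}

open scoped Classical in
/-- The set of the points `x` of the finite set `P` with `c₁ < f(x) - f(x*) ≤ c₂`. -/
def gridShell {d : ℕ} (D : Set (EuclideanSpace ℝ (Fin d)))
    (P : Finset (EuclideanSpace ℝ (Fin d))) (f : EuclideanSpace ℝ (Fin d) → ℝ) (c₁ c₂ : ℝ) :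
    Finset (EuclideanSpace ℝ (Fin d)) :=
  P.filter fun x => c₁ < f x - minValue D f ∧ f x - minValue D f ≤ c₂

/-- `P ⊆ D` is a `δ`-uniform grid of `D`: it contains every point of `D` that is one step of
length `δ` along a coordinate axis away from a point of `P`, and every point of `D` is within
distance `√d δ / 2` of `P`. -/
structure IsUniformGrid {d : ℕ} (δ : ℝ) (D : Set (EuclideanSpace ℝ (Fin d)))
    (P : Finset (EuclideanSpace ℝ (Fin d))) : Prop where
  subset : ∀ x ∈ P, x ∈ D
  step_add : ∀ x ∈ P, ∀ j : Fin d,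
    x + δ • EuclideanSpace.single j (1 : ℝ) ∈ D → x + δ • EuclideanSpace.single j (1 : ℝ) ∈ P
  step_sub : ∀ x ∈ P, ∀ j : Fin d,
    x - δ • EuclideanSpace.single j (1 : ℝ) ∈ D → x - δ • EuclideanSpace.single j (1 : ℝ) ∈ P
  cover : ∀ x ∈ D, ∃ y ∈ P, ‖y - x‖ ≤ Real.sqrt d * δ / 2

/-- The estimates built from the observations `obs t x` (`t ≥ 1`) with window length `T`:
`est t = (min{t, T+1} - 1) / min{t, T} * est (t-1) + 1 / min{t, T} * obs t
  - 1 / T * obs (t - T) * 1{t > T}`.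
The starting value is irrelevant, since its coefficient at `t = 1` is zero. -/
def estimate {X : Type*} (T : ℕ) (obs : ℕ → X → ℝ) : ℕ → X → ℝ
  | 0, _ => 0
  | t + 1, x =>
      (min ((t : ℝ) + 1) ((T : ℝ) + 1) - 1) / min ((t : ℝ) + 1) (T : ℝ) * estimate T obs t x
        + 1 / min ((t : ℝ) + 1) (T : ℝ) * obs (t + 1) x
        - (if T < t + 1 then 1 / (T : ℝ) * obs (t + 1 - T) x else 0)

/-- The set over which the hitting time `T(ε, a)` is the minimum: the window lengths `T ≥ 1` such
that at every time `t ≥ T`, with probability at least `1 - a`, the minimizers over `P` of the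
estimate (with window `T`) of `f t` are `ε`-optimal for `f t` over `D`. The observation at time `s`
at the point `x` is `f s x + N s x`. -/
def hittingSet {d : ℕ} {Ω : Type*} [MeasurableSpace Ω] (μ : MeasureTheory.Measure Ω)
    (D : Set (EuclideanSpace ℝ (Fin d))) (P : Finset (EuclideanSpace ℝ (Fin d)))
    (f : ℕ → EuclideanSpace ℝ (Fin d) → ℝ) (N : ℕ → EuclideanSpace ℝ (Fin d) → Ω → ℝ)
    (ε a : ℝ) : Set ℕ :=
  {T | 1 ≤ T ∧ ∀ t ≥ T, 1 - a ≤ μ.real {ω | ∀ x ∈ P,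
    (∀ y ∈ P, estimate T (fun s z => f s z + N s z ω) t x
        ≤ estimate T (fun s z => f s z + N s z ω) t y) →
      |f t x - minValue D (f t)| ≤ ε}}

/-- The ratio `m_l = 2^(d+1) K ε / (k (M - (l + 4) ε))`. -/
def shellRatio (d : ℕ) (K k M ε : ℝ) (l : ℕ) : ℝ :=
  2 ^ (d + 1) * K * ε / (k * (M - ((l : ℝ) + 4) * ε))

end

/-!
The bound on the number of grid points in the `l`-th shell rests on three facts about one convex
Lipschitz function `f` on the compact convex set `D`.

* The sublevel set `{f < f* + M}` lies in the interior of `D`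
  (`ConvexOn.mem_interior_of_homeomorph_sphere`). From a point `x` of it outside the interior, the
  convex set `D` is seen inside a closed half-space. Along each ray from `x` the level `f* + M` is
  attained at most once, so that projecting the level set radially from `x` and then along the
  normal of the half-space embeds a sphere of dimension `d - 1` in a space of dimension `d - 1`.
  This contradicts the no-retraction theorem, which is proved by the volume argument of Milnor and
  Rogers.
* The integrals of `‖∇ f‖` over two consecutive shells `c₁ < f ≤ c₂` and `c₂ < f ≤ c₃` satisfy
  `(c₃ - c₂) ∫ ≤ (c₂ - c₁) ∫` (`ConvexOn.lintegral_norm_gradient_shell_le`). On a line the total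
  variation of a convex function on the first shell is at most twice `c₂ - c₁`, and on the second
  shell at least twice `c₃ - c₂`, unless the line misses the set where `f < c₂`, and then the
  variation on the first shell is zero. Integrating over all lines in a direction `v`, and then
  over `v` in the unit ball, turns `|⟪∇ f, v⟫|` into a multiple of `‖∇ f‖`. This replaces the
  coarea formula. With `k ≤ ‖∇ f‖ ≤ K` it compares the volumes of the two shells.
* Numbers of grid points are compared with volumes separately in each class modulo `δ ℤ^d`
  (`ConvexOn.card_shell_mul_le`). Each grid point of the inner shell owns the cube of side `δ / 2`
  in the orthant of its gradient, on which `f` does not fall below its value at the point, and the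
  outer shell is covered by the cubes of side `δ` about the points of the class in it or close to
  it. All of these points belong to the grid, because a grid can be followed along a segment
  (`IsUniformGrid.mem_of_forall_add_mul`). The ratio of the volumes of the cubes is the factor
  `2^d`.

For the hitting time, the estimate is the average of the last `T` observations. Let `T` be the
least window for which the sum of exponentials is at most `a`. If the drift of `f` over this window
exceeded `2 ε / 7`, then the window would be so long that `T - 1` satisfied the same inequality
(`sum_mul_exp_le_of_lt_drift`). Hence the average of `f` over the window, which lags behind by half
of the window, differs from the current `f` by at most `ε / 7`, and a grid point of height above
`(l + 1) ε` can have a smaller estimate than a grid point of height at most `ε / 7` only if one of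
the two average noises is large (`one_sub_le_measureReal_forall_minimizer`). Hoeffding's inequality
bounds each of these events. In the union bound the numbers of points in the shells may be replaced
by the larger `n_l`, since the exponentials decrease in `l` and the total stays `n`
(`add_sum_mul_le_sum_mul_of_antitone`).
-/

/-! ### The no-retraction theorem and embeddings of spheres -/

section Retraction

open Metric MeasureTheory Set Polynomial

variable {E : Type*} [NormedAddCommGroup E] [InnerProductSpace ℝ E]

theorem exists_forall_det_id_add_pos :
    ∃ η > 0, ∀ A : E →L[ℝ] E, ‖A‖ < η → 0 < (ContinuousLinearMap.id ℝ E + A).det := by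
  have hc : ContinuousAt (fun A : E →L[ℝ] E => (ContinuousLinearMap.id ℝ E + A).det) 0 :=
    (ContinuousLinearMap.continuous_det.comp (continuous_const.add continuous_id)).continuousAt
  have h0 : (0 : ℝ) < (ContinuousLinearMap.id ℝ E + (0 : E →L[ℝ] E)).det := by
    simp [ContinuousLinearMap.det]
  have := hc.eventually (lt_mem_nhds h0)
  obtain ⟨η, hη, h⟩ := Metric.eventually_nhds_iff.1 this
  exact ⟨η, hη, fun A hA => h (by simpa using hA)⟩

/-- A Lipschitz map of the closed ball that vanishes on the sphere, extended by zero, keeps its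
Lipschitz constant: a segment that leaves the ball crosses the sphere. -/
theorem LipschitzOnWith.lipschitzWith_indicator_ball {C : ℝ≥0} {w : E → E}
    (hw : LipschitzOnWith C w (closedBall 0 1)) (h0 : ∀ x, ‖x‖ = 1 → w x = 0) :
    LipschitzWith C ((ball (0 : E) 1).indicator w) := by
  have hmix : ∀ x ∈ ball (0 : E) 1, ∀ y ∉ ball (0 : E) 1, dist (w x) 0 ≤ C * dist x y := by
    intro x hx y hy
    rw [mem_ball_zero_iff] at hx
    rw [mem_ball_zero_iff, not_lt] at hy
    obtain ⟨z, hz, hz1⟩ := ((convex_segment x y).isPreconnected).intermediate_value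
      (left_mem_segment ℝ x y) (right_mem_segment ℝ x y) continuous_norm.continuousOn
      (show (1 : ℝ) ∈ Icc ‖x‖ ‖y‖ from ⟨hx.le, hy⟩)
    have hz1 : ‖z‖ = 1 := hz1
    rw [← h0 z hz1]
    refine (hw.dist_le_mul x (by simpa using hx.le) z (by simp [hz1])).trans ?_
    have := dist_add_dist_of_mem_segment hz
    exact mul_le_mul_of_nonneg_left (by linarith [dist_nonneg (x := z) (y := y)]) C.2
  refine LipschitzWith.of_dist_le_mul fun x y => ?_
  by_cases hx : x ∈ ball (0 : E) 1 <;> by_cases hy : y ∈ ball (0 : E) 1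
  · simpa [indicator_of_mem, hx, hy] using
      hw.dist_le_mul x (ball_subset_closedBall hx) y (ball_subset_closedBall hy)
  · rw [indicator_of_mem hx, indicator_of_notMem hy]
    exact hmix x hx y hy
  · rw [indicator_of_notMem hx, indicator_of_mem hy, dist_comm, dist_comm x]
    exact hmix y hy x hx
  · rw [indicator_of_notMem hx, indicator_of_notMem hy, dist_self]
    positivity

variable [FiniteDimensional ℝ E]

/-- `det (id + t A)` is a polynomial in `t` of degree at most the dimension. -/
theorem exists_polynomial_eval_eq_det_id_add_smul (A : E →L[ℝ] E) :
    ∃ p : ℝ[X], p.natDegree ≤ Module.finrank ℝ E ∧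
      ∀ t : ℝ, p.eval t = (ContinuousLinearMap.id ℝ E + t • A).det := by
  let b := Module.finBasis ℝ E
  let M := LinearMap.toMatrix b b (A : E →ₗ[ℝ] E)
  refine ⟨Matrix.det ((X : ℝ[X]) • M.map C + (1 : Matrix _ _ ℝ).map C), ?_, fun t => ?_⟩
  · simpa using natDegree_det_X_add_C_le M 1
  · have h1 : (ContinuousLinearMap.id ℝ E + t • A).det = Matrix.det (1 + t • M) := by
      rw [ContinuousLinearMap.det, ← LinearMap.det_toMatrix b]
      congr 1
      simp [M]
    rw [h1, ← coe_evalRingHom, RingHom.map_det]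
    congr 1
    ext i j
    by_cases h : i = j <;> simp [h] <;> ring

/-- A solution of `x + u x = y` is a fixed point of the contraction `x ↦ y - u x`. -/
theorem bijective_id_add_of_lipschitzWith {C : ℝ≥0} (hC : C < 1) {u : E → E}
    (hu : LipschitzWith C u) : Function.Bijective fun x => x + u x := by
  have hcon : ∀ y, ContractingWith C fun x => y - u x := fun y =>
    ⟨hC, by
      simpa using (LipschitzWith.const y).sub hu⟩
  constructor
  · intro x y hxy
    have h := hu.dist_le_mul x y
    have h2 : dist (u x) (u y) = dist x y := by
      have : u x - u y = -(x - y) := by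
        have hxy : x + u x = y + u y := hxy
        rw [eq_sub_of_add_eq' hxy]; abel
      rw [dist_eq_norm, dist_eq_norm, this, norm_neg]
    rw [h2] at h
    have hC' : (C : ℝ) < 1 := by exact_mod_cast hC
    have : dist x y ≤ 0 := by nlinarith [dist_nonneg (x := x) (y := y)]
    exact dist_le_zero.1 this
  · intro y
    refine ⟨(hcon y).fixedPoint, ?_⟩
    have := (hcon y).fixedPoint_isFixedPt
    have h : y - u ((hcon y).fixedPoint) = (hcon y).fixedPoint := this
    change (hcon y).fixedPoint + u ((hcon y).fixedPoint) = y
    nth_rw 1 [← h]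
    abel

theorem det_fderiv_eq_zero_of_norm_eq_one {G : E → E} {x : E} (hG : DifferentiableAt ℝ G x)
    (h1 : ∀ᶠ y in nhds x, ‖G y‖ = 1) : (fderiv ℝ G x).det = 0 := by
  by_contra hdet
  -- `G` is orthogonal to its derivative, so the derivative is not surjective
  have horth : ∀ v, inner ℝ (G x) (fderiv ℝ G x v) = 0 := by
    intro v
    have h2 : (fun y => ‖G y‖ ^ 2) =ᶠ[nhds x] fun _ => (1 : ℝ) :=
      h1.mono fun y hy => by simp [hy]
    have h3 : HasFDerivAt (fun y => ‖G y‖ ^ 2) (0 : E →L[ℝ] ℝ) x :=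
      (hasFDerivAt_const (1 : ℝ) x).congr_of_eventuallyEq h2
    have h4 := hG.hasFDerivAt.norm_sq.unique h3
    have h5 := congrArg (fun L : E →L[ℝ] ℝ => L v) h4
    simpa using h5
  have hsurj : Function.Surjective (fderiv ℝ G x) :=
    ((LinearMap.equivOfDetNeZero (fderiv ℝ G x : E →ₗ[ℝ] E) hdet).surjective)
  obtain ⟨v, hv⟩ := hsurj (G x)
  have := horth v
  rw [hv, real_inner_self_eq_norm_sq, h1.self_of_nhds] at this
  norm_num at this

theorem image_ball_id_add_of_lipschitzWith {C : ℝ≥0} (hC : C < 1) {u : E → E}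
    (hu : LipschitzWith C u) (h0 : ∀ x, 1 ≤ ‖x‖ → u x = 0) :
    (fun x => x + u x) '' ball 0 1 = ball 0 1 := by
  have hb := bijective_id_add_of_lipschitzWith hC hu
  have hc : (fun x => x + u x) '' (ball 0 1)ᶜ = (ball 0 1)ᶜ := by
    have : EqOn (fun x => x + u x) id (ball 0 1)ᶜ := fun x hx => by
      have : 1 ≤ ‖x‖ := by simpa using hx
      simp [h0 x this]
    rw [this.image_eq, image_id]
  rw [image_compl_eq hb] at hc
  exact compl_injective hc

variable [MeasurableSpace E] [BorelSpace E]

theorem integrableOn_det_id_add_smul_fderiv {C : ℝ≥0} {u : E → E} (hu : LipschitzWith C u) (t : ℝ) :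
    IntegrableOn (fun x => (ContinuousLinearMap.id ℝ E + t • fderiv ℝ u x).det) (ball 0 1)
      (volume : Measure E) := by
  have hcont : Continuous fun A : E →L[ℝ] E => (ContinuousLinearMap.id ℝ E + t • A).det :=
    ContinuousLinearMap.continuous_det.comp (continuous_const.add (continuous_id.const_smul t))
  obtain ⟨B, hB⟩ := (isCompact_closedBall (0 : E →L[ℝ] E) C).exists_bound_of_continuousOn
    hcont.continuousOn
  refine Measure.integrableOn_of_bounded (M := B) measure_ball_lt_top.ne ?_ ?_
  · exact (hcont.measurable.comp (measurable_fderiv ℝ u)).aestronglyMeasurable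
  · refine Filter.Eventually.of_forall fun x => hB _ ?_
    simpa using norm_fderiv_le_of_lipschitz ℝ hu

/-- The volume swept by `id + t u` does not depend on `t`: the integral of its Jacobian determinant
is a polynomial in `t`, and it is the volume of the ball for all small `t`, where `id + t u` is a
bijection of the ball. -/
theorem integral_det_id_add_fderiv_eq {C : ℝ≥0} {u : E → E} (hu : LipschitzWith C u)
    (hd : ∀ x ∈ ball (0 : E) 1, DifferentiableAt ℝ u x) (h0 : ∀ x, 1 ≤ ‖x‖ → u x = 0) :
    ∫ x in ball (0 : E) 1, (ContinuousLinearMap.id ℝ E + fderiv ℝ u x).det =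
      volume.real (ball (0 : E) 1) := by
  obtain ⟨η, hη, hpos⟩ := exists_forall_det_id_add_pos (E := E)
  -- all the nodes `s / (i + 1)` lie in the range of `t` where `id + t u` is a bijection
  obtain ⟨s, hs0, hs⟩ : ∃ s : ℝ, 0 < s ∧ ∀ t : ℝ, 0 ≤ t → t ≤ s → t * C < 1 ∧ t * C < η := by
    have hC1 : (0 : ℝ) < C + 1 := by positivity
    refine ⟨min 1 η / (C + 1), by positivity, fun t ht hts => ?_⟩
    have h1 : t * (C + 1) ≤ min 1 η := (le_div_iff₀ hC1).1 hts
    have h2 : t * C < min 1 η := by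
      rcases ht.eq_or_lt with rfl | ht
      · simp [hη]
      · nlinarith
    exact ⟨h2.trans_le (min_le_left _ _), h2.trans_le (min_le_right _ _)⟩
  have hsmall : ∀ t : ℝ, 0 ≤ t → t ≤ s →
      ∫ x in ball (0 : E) 1, (ContinuousLinearMap.id ℝ E + t • fderiv ℝ u x).det =
        volume.real (ball (0 : E) 1) := by
    intro t ht hts
    obtain ⟨h1, h2⟩ := hs t ht hts
    have htu : LipschitzWith (t.toNNReal * C) fun x => t • u x := by
      refine LipschitzWith.of_dist_le_mul fun x y => ?_
      rw [dist_smul₀, Real.norm_of_nonneg ht]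
      rw [NNReal.coe_mul, Real.coe_toNNReal t ht, mul_assoc]
      exact mul_le_mul_of_nonneg_left (hu.dist_le_mul x y) ht
    have hlt : t.toNNReal * C < 1 := by
      rw [← NNReal.coe_lt_coe, NNReal.coe_mul, Real.coe_toNNReal t ht]
      exact h1
    have himg := image_ball_id_add_of_lipschitzWith hlt htu (fun x hx => by simp [h0 x hx])
    have hinj := (bijective_id_add_of_lipschitzWith hlt htu).injective
    have hder : ∀ x ∈ ball (0 : E) 1, HasFDerivWithinAt (fun x => x + t • u x)
        (ContinuousLinearMap.id ℝ E + t • fderiv ℝ u x) (ball 0 1) x := fun x hx =>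
      ((hasFDerivAt_id x).add ((hd x hx).hasFDerivAt.const_smul t)).hasFDerivWithinAt
    have hdet : ∀ x, 0 < (ContinuousLinearMap.id ℝ E + t • fderiv ℝ u x).det := fun x => by
      refine hpos _ ?_
      rw [norm_smul, Real.norm_of_nonneg ht]
      exact (mul_le_mul_of_nonneg_left (norm_fderiv_le_of_lipschitz ℝ hu) ht).trans_lt h2
    have hcv := lintegral_abs_det_fderiv_eq_addHaar_image volume measurableSet_ball hder
      hinj.injOn
    rw [himg] at hcv
    rw [integral_eq_lintegral_of_nonneg_ae (Filter.Eventually.of_forall fun x => (hdet x).le)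
      (integrableOn_det_id_add_smul_fderiv hu t).aestronglyMeasurable, Measure.real, ← hcv]
    congr 1
    refine lintegral_congr fun x => ?_
    rw [abs_of_pos (hdet x)]
  let n := Module.finrank ℝ E
  let v : ℕ → ℝ := fun i => s / (i + 1)
  have hv : InjOn v (Finset.range (n + 1)) := by
    intro i _ j _ hij
    have hi : (i : ℝ) + 1 ≠ 0 := by positivity
    have hj : (j : ℝ) + 1 ≠ 0 := by positivity
    have : s / ((i : ℝ) + 1) = s / (j + 1) := hij
    rw [div_eq_div_iff hi hj] at this
    have := mul_left_cancel₀ hs0.ne' this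
    exact_mod_cast (add_right_cancel this).symm
  have hv0 : ∀ i, 0 ≤ v i ∧ v i ≤ s := fun i =>
    ⟨by positivity, div_le_self hs0.le (by linarith [Nat.cast_nonneg (α := ℝ) i])⟩
  let c : ℕ → ℝ := fun i => (Lagrange.basis (Finset.range (n + 1)) v i).eval 1
  have hinterp : ∀ p : ℝ[X], p.natDegree ≤ n →
      p.eval 1 = ∑ i ∈ Finset.range (n + 1), p.eval (v i) * c i := by
    intro p hp
    have hdeg : p.degree < (Finset.range (n + 1)).card := by
      rw [Finset.card_range]
      exact (degree_le_natDegree).trans_lt (by exact_mod_cast Nat.lt_succ_of_le hp)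
    conv_lhs => rw [Lagrange.eq_interpolate hv hdeg]
    simp [Lagrange.interpolate_apply, eval_finsetSum, c]
  have hone : ∀ x, (ContinuousLinearMap.id ℝ E + fderiv ℝ u x).det =
      ∑ i ∈ Finset.range (n + 1),
        (ContinuousLinearMap.id ℝ E + v i • fderiv ℝ u x).det * c i := by
    intro x
    obtain ⟨p, hp, hpe⟩ := exists_polynomial_eval_eq_det_id_add_smul (fderiv ℝ u x)
    have := hinterp p hp
    simpa [hpe] using this
  have hsum : ∑ i ∈ Finset.range (n + 1), c i = 1 := by
    simpa using (hinterp 1 (by simp)).symm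
  simp_rw [hone]
  rw [integral_finsetSum _ fun i _ => (integrableOn_det_id_add_smul_fderiv hu (v i)).mul_const _]
  simp_rw [integral_mul_const]
  rw [Finset.sum_congr rfl fun i _ => by rw [hsmall (v i) (hv0 i).1 (hv0 i).2], ← Finset.mul_sum,
    hsum, mul_one]

/-- The no-retraction theorem for maps that are `C¹` near the closed ball. A retraction would have
Jacobian determinant zero in the ball, but the integral of the determinant is the volume of the
ball. -/
theorem not_exists_contDiffAt_retraction {G : E → E}
    (hG : ∀ x ∈ closedBall (0 : E) 1, ContDiffAt ℝ 1 G x)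
    (h1 : ∀ x ∈ closedBall (0 : E) 1, ‖G x‖ = 1) (hid : ∀ x, ‖x‖ = 1 → G x = x) : False := by
  have hdiff : ∀ x ∈ closedBall (0 : E) 1, DifferentiableAt ℝ (fun y => G y - y) x := fun x hx =>
    ((hG x hx).differentiableAt (by norm_num)).sub differentiableAt_id
  have hcont : ContinuousOn (fderiv ℝ fun y => G y - y) (closedBall 0 1) := fun x hx =>
    (((hG x hx).sub contDiffAt_id).continuousAt_fderiv (by norm_num)).continuousWithinAt
  obtain ⟨C, hC⟩ := (isCompact_closedBall (0 : E) 1).exists_bound_of_continuousOn hcont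
  have hlip : LipschitzOnWith C.toNNReal (fun y => G y - y) (closedBall 0 1) :=
    (convex_closedBall (0 : E) 1).lipschitzOnWith_of_nnnorm_fderiv_le hdiff fun x hx => by
      rw [← NNReal.coe_le_coe, coe_nnnorm]
      exact (hC x hx).trans (Real.le_coe_toNNReal C)
  have hu := hlip.lipschitzWith_indicator_ball fun x hx => by simp [hid x hx]
  have hev : ∀ x ∈ ball (0 : E) 1,
      (ball (0 : E) 1).indicator (fun y => G y - y) =ᶠ[nhds x] fun y => G y - y := fun x hx =>
    (Filter.eventually_of_mem (isOpen_ball.mem_nhds hx) fun y hy => indicator_of_mem hy _)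
  have hint := integral_det_id_add_fderiv_eq hu
    (fun x hx => (hdiff x (ball_subset_closedBall hx)).congr_of_eventuallyEq (hev x hx))
    (fun x hx => indicator_of_notMem (by simpa using hx) _)
  have hzero : ∀ x ∈ ball (0 : E) 1, (ContinuousLinearMap.id ℝ E +
      fderiv ℝ ((ball (0 : E) 1).indicator fun y => G y - y) x).det = 0 := by
    intro x hx
    have hGx : DifferentiableAt ℝ G x :=
      (hG x (ball_subset_closedBall hx)).differentiableAt (by norm_num)
    rw [(hev x hx).fderiv_eq, fderiv_fun_sub hGx differentiableAt_fun_id, fderiv_fun_id,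
      add_sub_cancel]
    exact det_fderiv_eq_zero_of_norm_eq_one hGx
      (Filter.eventually_of_mem (isOpen_ball.mem_nhds hx) fun y hy =>
        h1 y (ball_subset_closedBall hy))
  rw [setIntegral_congr_fun measurableSet_ball hzero, integral_zero] at hint
  have : 0 < volume.real (ball (0 : E) 1) :=
    ENNReal.toReal_pos (measure_ball_pos _ _ one_pos).ne' measure_ball_lt_top.ne
  exact this.ne hint

/-- A smooth map that stays close to the identity on the unit sphere vanishes somewhere in the
ball. Otherwise it could be deformed near the sphere into the identity there without acquiring
zeros, and its normalization would be a retraction. -/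
theorem ContDiff.exists_eq_zero_of_norm_sub_lt_one {F : E → E} (hF : ContDiff ℝ 1 F)
    (h1 : ∀ x, ‖x‖ = 1 → ‖F x - x‖ < 1) : ∃ x ∈ closedBall (0 : E) 1, F x = 0 := by
  by_contra! hne
  -- the closed set where `F` may be far from the identity lies in a smaller ball
  let S : Set E := closedBall 0 1 ∩ {x | ‖x‖ ≤ ‖F x - x‖}
  have hS : IsCompact S := (isCompact_closedBall _ _).inter_right
    (isClosed_le continuous_norm (hF.continuous.sub continuous_id).norm)
  obtain ⟨ρ, hρ0, hρ1, hρ⟩ : ∃ ρ : ℝ, 0 < ρ ∧ ρ < 1 ∧ ∀ x ∈ S, ‖x‖ ≤ ρ := by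
    rcases S.eq_empty_or_nonempty with he | hne
    · exact ⟨1 / 2, by norm_num, by norm_num, by simp [he]⟩
    · obtain ⟨z, hz, hmax⟩ := hS.exists_isMaxOn hne continuous_norm.continuousOn
      have hz1 : ‖z‖ < 1 := by
        refine lt_of_le_of_ne (by simpa using hz.1) fun h => ?_
        have h3 : ‖z‖ ≤ ‖F z - z‖ := hz.2
        linarith [h1 z h]
      refine ⟨max ‖z‖ (1 / 2), by positivity, max_lt hz1 (by norm_num), fun x hx =>
        (hmax hx).trans (le_max_left _ _)⟩
  let χ : ContDiffBump (0 : E) := ⟨ρ, 1, hρ0, hρ1⟩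
  let H : E → E := fun x => x + χ x • (F x - x)
  have hH : ContDiff ℝ 1 H :=
    contDiff_id.add (χ.contDiff.smul (hF.sub contDiff_id))
  have hH0 : ∀ x ∈ closedBall (0 : E) 1, H x ≠ 0 := by
    intro x hx h0
    by_cases hxρ : ‖x‖ ≤ ρ
    · have : χ x = 1 := χ.one_of_mem_closedBall (by simpa using hxρ)
      simp only [H, this, one_smul, add_sub_cancel] at h0
      exact hne x hx h0
    · have hxS : ‖F x - x‖ < ‖x‖ := by
        by_contra h
        exact hxρ (hρ x ⟨hx, not_lt.1 h⟩)
      have h2 : ‖x‖ ≤ ‖F x - x‖ := by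
        have h3 : ‖x‖ = χ x * ‖F x - x‖ := by
          rw [← norm_neg x, ← eq_neg_of_add_eq_zero_right h0, norm_smul,
            Real.norm_of_nonneg χ.nonneg]
        rw [h3]
        exact mul_le_of_le_one_left (norm_nonneg (F x - x)) χ.le_one
      linarith
  refine not_exists_contDiffAt_retraction (G := fun x => ‖H x‖⁻¹ • H x) (fun x hx => ?_)
    (fun x hx => ?_) fun x hx => ?_
  · exact ((hH.contDiffAt.norm ℝ (hH0 x hx)).inv (norm_ne_zero_iff.2 (hH0 x hx))).smul
      hH.contDiffAt
  · rw [norm_smul, norm_inv, norm_norm, inv_mul_cancel₀ (norm_ne_zero_iff.2 (hH0 x hx))]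
  · have h2 : χ x = 0 := χ.zero_of_le_dist (by simp [χ, hx])
    simp [H, h2, hx]

theorem Continuous.exists_eq_zero_of_norm_sub_lt {F : E → E} (hF : Continuous F)
    (h1 : ∀ x, ‖x‖ = 1 → ‖F x - x‖ < 1 / 2) : ∃ x ∈ closedBall (0 : E) 1, F x = 0 := by
  by_contra! hne
  obtain ⟨x₀, hx₀, hmin⟩ := (isCompact_closedBall (0 : E) 1).exists_isMinOn
    ⟨(0 : E), by simp⟩ hF.norm.continuousOn
  have hη : 0 < ‖F x₀‖ := norm_pos_iff.2 (hne x₀ hx₀)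
  obtain ⟨g, hg, hgF, -⟩ := hF.exists_contDiff_approx 1
    (ε := fun _ => min ‖F x₀‖ (1 / 2)) continuous_const (fun _ => by positivity)
  obtain ⟨x, hx, hx0⟩ := ContDiff.exists_eq_zero_of_norm_sub_lt_one (F := g)
    (by exact_mod_cast hg) fun x hx => by
      have h2 := (hgF x).trans_le (min_le_right _ _)
      rw [dist_eq_norm] at h2
      calc ‖g x - x‖ = ‖(g x - F x) + (F x - x)‖ := by congr 1; abel
        _ ≤ ‖g x - F x‖ + ‖F x - x‖ := norm_add_le _ _
        _ < 1 := by linarith [h1 x hx]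
  have h2 := (hgF x).trans_le (min_le_left _ _)
  rw [hx0, dist_zero_left] at h2
  exact absurd (hmin hx) (not_le.2 h2)

/-- The unit sphere of `E` does not embed in a space of smaller dimension than `E`. The inverse of
an embedding `g` extends to a map `H : V → E` by Tietze, and `g` to all of `E`. A smooth
approximation of `H` has a null image, so it misses small vectors `c`, although its composition
with `g` is close to the identity on the sphere. -/
theorem not_injective_sphere_of_finrank_lt {V : Type*} [NormedAddCommGroup V] [NormedSpace ℝ V]
    [FiniteDimensional ℝ V] (hdim : Module.finrank ℝ V < Module.finrank ℝ E)
    {g : sphere (0 : E) 1 → V} (hg : Continuous g) : ¬ Function.Injective g := by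
  intro hinj
  have : CompactSpace (sphere (0 : E) 1) := isCompact_iff_compactSpace.1 (isCompact_sphere _ _)
  have hemb : Topology.IsClosedEmbedding g := hg.isClosedEmbedding hinj
  have : TietzeExtension E := TietzeExtension.of_tvs ℝ
  have : TietzeExtension V := TietzeExtension.of_tvs ℝ
  obtain ⟨H, hH⟩ := ContinuousMap.exists_extension' hemb
    (⟨Subtype.val, continuous_subtype_val⟩ : C(sphere (0 : E) 1, E))
  obtain ⟨g', hg'⟩ := ContinuousMap.exists_restrict_eq (isClosed_sphere (x := (0 : E)) (ε := 1))
    (⟨g, hg⟩ : C(sphere (0 : E) 1, V))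
  obtain ⟨H', hH', hH'H, -⟩ := H.continuous.exists_contDiff_approx 1
    (ε := fun _ => 1 / 4) continuous_const (fun _ => by norm_num)
  have hdense := ContDiff.dense_compl_range_of_finrank_lt_finrank
    (f := H') (by exact_mod_cast hH') hdim
  obtain ⟨c, hc, hcball⟩ := hdense.exists_dist_lt (0 : E) (ε := 1 / 4) (by norm_num)
  rw [dist_zero_left] at hcball
  obtain ⟨x, -, hx⟩ := Continuous.exists_eq_zero_of_norm_sub_lt (F := fun x => H' (g' x) - c)
    ((hH'.continuous.comp g'.continuous).sub continuous_const) fun x hx => by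
      have h1 : g' x = g ⟨x, by simpa using hx⟩ :=
        congrArg (fun φ : C(sphere (0 : E) 1, V) => φ ⟨x, by simpa using hx⟩) hg'
      have h2 : H (g' x) = x := by
        rw [h1]; exact congrFun hH ⟨x, by simpa using hx⟩
      have h3 := hH'H (g' x)
      rw [h2, dist_eq_norm] at h3
      calc ‖H' (g' x) - c - x‖ = ‖(H' (g' x) - x) - c‖ := by congr 1; abel
        _ ≤ ‖H' (g' x) - x‖ + ‖c‖ := norm_sub_le _ _
        _ < 1 / 2 := by linarith
  exact hc ⟨g' x, sub_eq_zero.1 hx⟩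

end Retraction

/-! ### Sublevel sets of convex functions and the interior of the domain -/

section Interior

open Metric Set

variable {E : Type*} [NormedAddCommGroup E] [InnerProductSpace ℝ E] [FiniteDimensional ℝ E]

/-- Supporting hyperplanes of a convex set, which may have empty interior. -/
theorem Convex.exists_ne_zero_forall_inner_sub_nonpos {D : Set E} (hD : Convex ℝ D) {x : E}
    (hxD : x ∈ D) (hx : x ∉ interior D) : ∃ w : E, w ≠ 0 ∧ ∀ z ∈ D, inner ℝ w (z - x) ≤ 0 := by
  rcases (interior D).eq_empty_or_nonempty with hemp | hne
  · have hspan : affineSpan ℝ D ≠ ⊤ := fun h => by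
      have := hD.interior_nonempty_iff_affineSpan_eq_top.2 h
      simp [hemp] at this
    have hdir : (affineSpan ℝ D).direction ≠ ⊤ := fun h => hspan
      ((AffineSubspace.direction_eq_top_iff_of_nonempty
        ⟨x, subset_affineSpan ℝ D hxD⟩).1 h)
    have hbot : ((affineSpan ℝ D).direction)ᗮ ≠ ⊥ := fun h =>
      hdir (Submodule.orthogonal_eq_bot_iff.1 h)
    obtain ⟨w, hw, hw0⟩ := Submodule.exists_mem_ne_zero_of_ne_bot hbot
    refine ⟨w, hw0, fun z hz => le_of_eq ?_⟩
    rw [real_inner_comm]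
    exact (Submodule.mem_orthogonal _ w).1 hw _ (AffineSubspace.vsub_mem_direction
      (subset_affineSpan ℝ D hz) (subset_affineSpan ℝ D hxD))
  · obtain ⟨φ, hφ0, hφ⟩ := geometric_hahn_banach_of_nonempty_interior_point hD hx hne
    refine ⟨(InnerProductSpace.toDual ℝ E).symm φ, by simpa using hφ0, fun z hz => ?_⟩
    rw [InnerProductSpace.toDual_symm_apply, map_sub]
    linarith [hφ z hz]

/-- If a level set of a convex function is a sphere, then the lower values are taken in the
interior of the domain only. Seen from a point outside the interior of the convex set `D`, the set
`D` lies in a closed half-space, so that the radial projection followed by the projection along the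
normal of the half-space would embed a level set of dimension `dim E - 1` in a space of that
dimension. -/
theorem ConvexOn.mem_interior_of_homeomorph_sphere {D : Set E} {f : E → ℝ} (hf : ConvexOn ℝ D f)
    {c : ℝ} (hsphere : Nonempty ({z | z ∈ D ∧ f z = c} ≃ₜ sphere (0 : E) 1)) {x : E} (hxD : x ∈ D)
    (hx : f x < c) : x ∈ interior D := by
  by_contra hint
  obtain ⟨w, hw0, hw⟩ := hf.1.exists_ne_zero_forall_inner_sub_nonpos hxD hint
  obtain ⟨φ⟩ := hsphere
  borelize E
  let V : Submodule ℝ E := (ℝ ∙ w)ᗮ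
  have hdim : Module.finrank ℝ V < Module.finrank ℝ E := by
    have h1 := Submodule.finrank_add_finrank_orthogonal (ℝ ∙ w)
    rw [finrank_span_singleton hw0] at h1
    change Module.finrank ℝ ((ℝ ∙ w)ᗮ : Submodule ℝ E) < _
    omega
  have hne : ∀ z : {z | z ∈ D ∧ f z = c}, (z : E) - x ≠ 0 := fun z h => by
    have h1 : (z : E) = x := sub_eq_zero.1 h
    have h2 := z.2.2
    rw [h1] at h2
    exact hx.ne h2
  let g : {z | z ∈ D ∧ f z = c} → V := fun z =>
    V.orthogonalProjectionOnto (‖(z : E) - x‖⁻¹ • ((z : E) - x))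
  have hg : Continuous g := by
    refine V.orthogonalProjectionOnto.continuous.comp ?_
    exact ((continuous_subtype_val.sub continuous_const).norm.inv₀ fun z =>
      norm_ne_zero_iff.2 (hne z)).smul (continuous_subtype_val.sub continuous_const)
  refine not_injective_sphere_of_finrank_lt hdim (hg.comp φ.symm.continuous)
    (Function.Injective.comp ?_ φ.symm.injective)
  -- two points of the level set on one ray from `x` coincide
  have hray : ∀ z z' : {z | z ∈ D ∧ f z = c}, ∀ r : ℝ, 0 ≤ r → r < 1 →
      (z : E) - x ≠ r • ((z' : E) - x) := by
    intro z z' r hr0 hr1 h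
    have h1 : (z : E) = (1 - r) • x + r • (z' : E) := by
      rw [sub_eq_iff_eq_add.1 h, smul_sub, sub_smul, one_smul]; abel
    have h2 := hf.2 hxD z'.2.1 (sub_nonneg.2 hr1.le) hr0 (by ring)
    have h3 := z.2.2
    have h4 := z'.2.2
    rw [← h1, h3, h4, smul_eq_mul, smul_eq_mul] at h2
    nlinarith
  intro z z' hzz
  set p := (z : E) - x with hp
  set p' := (z' : E) - x with hp'
  have hp0 : 0 < ‖p‖ := norm_pos_iff.2 (hne z)
  have hp'0 : 0 < ‖p'‖ := norm_pos_iff.2 (hne z')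
  have hmem : ‖p‖⁻¹ • p - ‖p'‖⁻¹ • p' ∈ (ℝ ∙ w) := by
    have h1 : V.orthogonalProjectionOnto (‖p‖⁻¹ • p - ‖p'‖⁻¹ • p') = 0 := by
      rw [map_sub, sub_eq_zero]; exact hzz
    have h2 := (Submodule.orthogonalProjectionOnto_eq_zero_iff).1 h1
    rwa [Submodule.orthogonal_orthogonal] at h2
  obtain ⟨a, ha⟩ := Submodule.mem_span_singleton.1 hmem
  have hu : ‖‖p‖⁻¹ • p‖ = 1 := by
    rw [norm_smul, norm_inv, norm_norm, inv_mul_cancel₀ hp0.ne']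
  have hu' : ‖‖p'‖⁻¹ • p'‖ = 1 := by
    rw [norm_smul, norm_inv, norm_norm, inv_mul_cancel₀ hp'0.ne']
  have hwu : inner ℝ w (‖p‖⁻¹ • p) ≤ 0 := by
    rw [inner_smul_right]
    exact mul_nonpos_of_nonneg_of_nonpos (by positivity) (hw _ z.2.1)
  have hwu' : inner ℝ w (‖p'‖⁻¹ • p') ≤ 0 := by
    rw [inner_smul_right]
    exact mul_nonpos_of_nonneg_of_nonpos (by positivity) (hw _ z'.2.1)
  -- two unit vectors that differ by a multiple of `w` are equal or mirror images of each other in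
  -- the hyperplane orthogonal to `w`, and mirror images in one closed half-space coincide
  have huu : ‖p‖⁻¹ • p = ‖p'‖⁻¹ • p' := by
    set u := ‖p‖⁻¹ • p
    set u' := ‖p'‖⁻¹ • p'
    have hu2 : u = u' + a • w := by rw [ha]; abel
    have hsq : ‖u' + a • w‖ ^ 2 = 1 := by rw [← hu2, hu, one_pow]
    have hwa : inner ℝ w u = inner ℝ w u' + a * ‖w‖ ^ 2 := by
      rw [hu2, inner_add_right, real_inner_smul_right w w a, real_inner_self_eq_norm_sq]
    rw [norm_add_sq_real, hu', real_inner_smul_right u' w a, real_inner_comm, norm_smul, mul_pow,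
      Real.norm_eq_abs, sq_abs] at hsq
    have hw2 : 0 < ‖w‖ ^ 2 := by positivity
    have h1 : a * (inner ℝ w u + inner ℝ w u') = 0 := by rw [hwa]; linarith
    rcases mul_eq_zero.1 h1 with h0 | h0
    · rw [hu2, h0, zero_smul, add_zero]
    · have h2 : a * ‖w‖ ^ 2 = 0 := by linarith
      rcases mul_eq_zero.1 h2 with h3 | h3
      · rw [hu2, h3, zero_smul, add_zero]
      · exact absurd h3 hw2.ne'
  have hpp : p = (‖p‖ / ‖p'‖) • p' := by
    rw [div_eq_mul_inv, mul_smul, ← huu, smul_inv_smul₀ hp0.ne']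
  have hpp' : p' = (‖p'‖ / ‖p‖) • p := by
    rw [div_eq_mul_inv, mul_smul, huu, smul_inv_smul₀ hp'0.ne']
  rcases lt_trichotomy ‖p‖ ‖p'‖ with hlt | heq | hlt
  · exact absurd hpp (hray z z' _ (by positivity) ((div_lt_one hp'0).2 hlt))
  · rw [heq, div_self hp'0.ne', one_smul] at hpp
    exact Subtype.ext (sub_left_injective hpp)
  · exact absurd hpp' (hray z' z _ (by positivity) ((div_lt_one hp0).2 hlt))

end Interior

/-! ### Variation of a convex function of one variable on its shells -/

section Line

open MeasureTheory Set

theorem MonotoneOn.deriv_nonneg_of_mem_Ioo {g : ℝ → ℝ} {a b t : ℝ} (hg : MonotoneOn g (Icc a b))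
    (ht : t ∈ Ioo a b) : 0 ≤ deriv g t := by
  rw [← derivWithin_of_mem_nhds (Icc_mem_nhds ht.1 ht.2)]
  exact hg.derivWithin_nonneg

theorem lintegral_abs_deriv_Ioo_of_monotoneOn {g : ℝ → ℝ} {a b : ℝ} (hab : a ≤ b)
    (hc : ContinuousOn g (Icc a b)) (hm : MonotoneOn g (Icc a b))
    (hd : ∀ t ∈ Ioo a b, DifferentiableAt ℝ g t) :
    ∫⁻ t in Ioo a b, ENNReal.ofReal |deriv g t| = ENNReal.ofReal (g b - g a) := by
  have hint : IntegrableOn (deriv g) (Ioc a b) :=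
    intervalIntegral.integrableOn_deriv_of_nonneg hc (fun t ht => (hd t ht).hasDerivAt)
      fun t ht => hm.deriv_nonneg_of_mem_Ioo ht
  have hftc : ∫ t in a..b, deriv g t = g b - g a :=
    intervalIntegral.integral_eq_sub_of_hasDerivAt_of_le hab hc (fun t ht => (hd t ht).hasDerivAt)
      ((intervalIntegrable_iff_integrableOn_Ioc_of_le hab).2 hint)
  rw [← hftc, intervalIntegral.integral_of_le hab, integral_Ioc_eq_integral_Ioo,
    ofReal_integral_eq_lintegral_ofReal (hint.mono_set Ioo_subset_Ioc_self)
      ((ae_restrict_iff' measurableSet_Ioo).2 (Filter.Eventually.of_forall fun t ht =>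
        hm.deriv_nonneg_of_mem_Ioo ht))]
  exact setLIntegral_congr_fun measurableSet_Ioo fun t ht => by
    simp only [abs_of_nonneg (hm.deriv_nonneg_of_mem_Ioo ht)]

/-- To the right of a minimizer of the convex function `g`, the total variation of `g` on the part
where `c₁ < g ≤ c₂` is at most `c₂ - c₁`, and on the part where `c₂ < g ≤ c₃` at least `c₃ - c₂`.
-/
theorem ConvexOn.lintegral_abs_deriv_shell_right {g : ℝ → ℝ} {I : Set ℝ} (hI : IsCompact I)
    (hg : ConvexOn ℝ I g) (hc : ContinuousOn g I) {c₁ c₂ c₃ c₄ : ℝ} (h12 : c₁ < c₂) (h23 : c₂ < c₃)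
    (h34 : c₃ < c₄) (hint : ∀ t ∈ I, g t < c₄ → t ∈ interior I)
    (hd : ∀ t ∈ I, c₁ < g t → g t < c₄ → DifferentiableAt ℝ g t)
    {t₀ : ℝ} (ht₀ : t₀ ∈ I) (hmin : IsMinOn g I t₀) (hlt : g t₀ < c₂) :
    ∫⁻ t in {t | t ∈ I ∧ c₁ < g t ∧ g t ≤ c₂} ∩ Ioi t₀, ENNReal.ofReal |deriv g t| ≤
        ENNReal.ofReal (c₂ - c₁) ∧
      ENNReal.ofReal (c₃ - c₂) ≤
        ∫⁻ t in {t | t ∈ I ∧ c₂ < g t ∧ g t ≤ c₃} ∩ Ioi t₀, ENNReal.ofReal |deriv g t| := by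
  obtain ⟨q, hqI, hq⟩ := hI.exists_isMaxOn ⟨t₀, ht₀⟩ continuousOn_id
  have hqmax : ∀ t ∈ I, t ≤ q := fun t ht => hq ht
  -- the endpoint `q` of `I` is not interior, so the value there is high
  have hgq : c₄ ≤ g q := by
    by_contra! h
    have hn := mem_interior_iff_mem_nhds.1 (hint q hqI h)
    obtain ⟨ε, hε, hball⟩ := Metric.mem_nhds_iff.1 hn
    have : q + ε / 2 ∈ I := hball (by
      rw [Metric.mem_ball, Real.dist_eq, add_sub_cancel_left, abs_of_pos (by linarith)]; linarith)
    linarith [hqmax _ this]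
  have hsub : Icc t₀ q ⊆ I := hg.1.ordConnected.out ht₀ hqI
  have ht₀q : t₀ ≤ q := hqmax _ ht₀
  have hc' : ContinuousOn g (Icc t₀ q) := hc.mono hsub
  have hstrict : ∀ s ∈ Icc t₀ q, ∀ t ∈ Icc t₀ q, s < t → g t₀ < g s → g s < g t := by
    intro s hs t ht hst hgs
    have hs0 : t₀ < s := lt_of_le_of_ne hs.1 (by rintro rfl; exact lt_irrefl _ hgs)
    refine hg.lt_right_of_left_lt ht₀ (hsub ht) ?_ hgs
    rw [openSegment_eq_Ioo (hs0.trans hst)]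
    exact ⟨hs0, hst⟩
  have hmono : MonotoneOn g (Icc t₀ q) := by
    intro s hs t ht hst
    rcases hst.eq_or_lt with rfl | hst
    · exact le_rfl
    · rcases (show g t₀ ≤ g s from hmin (hsub hs)).eq_or_lt with h | h
      · rw [← h]; exact hmin (hsub ht)
      · exact (hstrict s hs t ht hst h).le
  have hivt : ∀ c, g t₀ ≤ c → c ≤ c₄ → ∃ b ∈ Icc t₀ q, g b = c := fun c h1 h2 =>
    intermediate_value_Icc ht₀q hc' ⟨h1, h2.trans hgq⟩
  obtain ⟨b₂, hb₂, hgb₂⟩ := hivt c₂ hlt.le (by linarith)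
  obtain ⟨b₃, hb₃, hgb₃⟩ := hivt c₃ (by linarith) h34.le
  -- `b₁` is the last point where `g ≤ c₁`, or `t₀` if there is none
  obtain ⟨b₁, hb₁, hgb₁, hb₁1, hb₁2⟩ : ∃ b₁ ∈ Icc t₀ q, c₁ ≤ g b₁ ∧
      (∀ t ∈ Icc t₀ q, b₁ < t → c₁ < g t) ∧ ∀ t ∈ Icc t₀ q, c₁ < g t → b₁ ≤ t := by
    rcases lt_or_ge c₁ (g t₀) with h | h
    · exact ⟨t₀, ⟨le_rfl, ht₀q⟩, h.le, fun t ht _ => h.trans_le (hmin (hsub ht)),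
        fun t ht _ => ht.1⟩
    · have hS : IsCompact (Icc t₀ q ∩ g ⁻¹' Iic c₁) :=
        isCompact_Icc.of_isClosed_subset
          (hc'.preimage_isClosed_of_isClosed isClosed_Icc isClosed_Iic) inter_subset_left
      obtain ⟨b, hb, hbmax⟩ := hS.exists_isMaxOn ⟨t₀, ⟨le_rfl, ht₀q⟩, h⟩ continuousOn_id
      obtain ⟨s, hs, hgs⟩ := hivt c₁ h (by linarith)
      have hbs : s ≤ b := hbmax ⟨hs, hgs.le⟩
      refine ⟨b, hb.1, by rw [← hgs]; exact hmono hs hb.1 hbs, fun t ht hbt => ?_,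
        fun t ht hct => ?_⟩
      · by_contra! hle
        exact absurd (hbmax ⟨ht, hle⟩ : t ≤ b) (not_le.2 hbt)
      · by_contra! hle
        exact absurd (hmono ht hb.1 hle.le) (not_le.2 (lt_of_le_of_lt hb.2 hct))
  have hb12 : b₁ ≤ b₂ := hb₁2 b₂ hb₂ (by rw [hgb₂]; exact h12)
  have hb23 : b₂ ≤ b₃ := by
    by_contra! h
    have := hmono hb₃ hb₂ h.le
    linarith
  have hsub12 : Icc b₁ b₂ ⊆ Icc t₀ q := Icc_subset_Icc hb₁.1 hb₂.2
  have hsub23 : Icc b₂ b₃ ⊆ Icc t₀ q := Icc_subset_Icc hb₂.1 hb₃.2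
  constructor
  · calc ∫⁻ t in {t | t ∈ I ∧ c₁ < g t ∧ g t ≤ c₂} ∩ Ioi t₀, ENNReal.ofReal |deriv g t|
        ≤ ∫⁻ t in Icc b₁ b₂, ENNReal.ofReal |deriv g t| := by
          refine lintegral_mono_set fun t ht => ?_
          have htI : t ∈ Icc t₀ q := ⟨(mem_Ioi.1 ht.2).le, hqmax t ht.1.1⟩
          refine ⟨hb₁2 t htI ht.1.2.1, ?_⟩
          by_contra! h
          have := hstrict b₂ hb₂ t htI h (by rw [hgb₂]; exact hlt)
          linarith [ht.1.2.2]
      _ = ∫⁻ t in Ioo b₁ b₂, ENNReal.ofReal |deriv g t| :=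
          setLIntegral_congr Ioo_ae_eq_Icc.symm
      _ = ENNReal.ofReal (g b₂ - g b₁) := by
          refine lintegral_abs_deriv_Ioo_of_monotoneOn hb12 (hc'.mono hsub12) (hmono.mono hsub12)
            fun t ht => ?_
          have htI := hsub12 (Ioo_subset_Icc_self ht)
          refine hd t (hsub htI) (hb₁1 t htI ht.1) ?_
          have := hmono htI hb₂ ht.2.le
          linarith
      _ ≤ ENNReal.ofReal (c₂ - c₁) := ENNReal.ofReal_le_ofReal (by linarith)
  · calc ENNReal.ofReal (c₃ - c₂) = ∫⁻ t in Ioo b₂ b₃, ENNReal.ofReal |deriv g t| := by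
          rw [lintegral_abs_deriv_Ioo_of_monotoneOn hb23 (hc'.mono hsub23) (hmono.mono hsub23),
            hgb₂, hgb₃]
          intro t ht
          have htI := hsub23 (Ioo_subset_Icc_self ht)
          have h1 := hmono htI hb₃ ht.2.le
          have h2 := hmono hb₂ htI ht.1.le
          exact hd t (hsub htI) (by linarith) (by linarith)
      _ ≤ _ := by
          refine lintegral_mono_set fun t ht => ?_
          have htI := hsub23 (Ioo_subset_Icc_self ht)
          have h1 := hmono htI hb₃ ht.2.le
          have h2 := hstrict b₂ hb₂ t htI ht.1 (by rw [hgb₂]; exact hlt)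
          exact ⟨⟨hsub htI, by linarith, by linarith⟩, lt_of_le_of_lt hb₂.1 ht.1⟩

/-- The mirror image of `ConvexOn.lintegral_abs_deriv_shell_right`. -/
theorem ConvexOn.lintegral_abs_deriv_shell_left {g : ℝ → ℝ} {I : Set ℝ} (hI : IsCompact I)
    (hg : ConvexOn ℝ I g) (hc : ContinuousOn g I) {c₁ c₂ c₃ c₄ : ℝ} (h12 : c₁ < c₂) (h23 : c₂ < c₃)
    (h34 : c₃ < c₄) (hint : ∀ t ∈ I, g t < c₄ → t ∈ interior I)
    (hd : ∀ t ∈ I, c₁ < g t → g t < c₄ → DifferentiableAt ℝ g t)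
    {t₀ : ℝ} (ht₀ : t₀ ∈ I) (hmin : IsMinOn g I t₀) (hlt : g t₀ < c₂) :
    ∫⁻ t in {t | t ∈ I ∧ c₁ < g t ∧ g t ≤ c₂} ∩ Iio t₀, ENNReal.ofReal |deriv g t| ≤
        ENNReal.ofReal (c₂ - c₁) ∧
      ENNReal.ofReal (c₃ - c₂) ≤
        ∫⁻ t in {t | t ∈ I ∧ c₂ < g t ∧ g t ≤ c₃} ∩ Iio t₀, ENNReal.ofReal |deriv g t| := by
  have hneg : ∀ a b : ℝ,
      ∫⁻ t in {t | t ∈ I ∧ a < g t ∧ g t ≤ b} ∩ Iio t₀, ENNReal.ofReal |deriv g t| =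
      ∫⁻ t in {t | t ∈ Neg.neg ⁻¹' I ∧ a < g (-t) ∧ g (-t) ≤ b} ∩ Ioi (-t₀),
        ENNReal.ofReal |deriv (fun s => g (-s)) t| := by
    intro a b
    have hpre : {t | t ∈ Neg.neg ⁻¹' I ∧ a < g (-t) ∧ g (-t) ≤ b} ∩ Ioi (-t₀) =
        Neg.neg ⁻¹' ({t | t ∈ I ∧ a < g t ∧ g t ≤ b} ∩ Iio t₀) := by
      ext t
      simp only [mem_inter_iff, mem_ofPred_eq, mem_preimage, mem_Ioi, mem_Iio, neg_lt]
    rw [hpre, ← (Measure.measurePreserving_neg (volume : Measure ℝ)).setLIntegral_comp_preimage_emb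
      (MeasurableEquiv.neg ℝ).measurableEmbedding]
    refine lintegral_congr fun t => ?_
    rw [deriv_comp_neg, abs_neg]
  rw [hneg, hneg]
  have hhom : IsCompact (Neg.neg ⁻¹' I) := by
    simpa using hI.neg
  have hconv : ConvexOn ℝ (Neg.neg ⁻¹' I) fun t => g (-t) :=
    hg.comp_linearMap (-LinearMap.id)
  refine ConvexOn.lintegral_abs_deriv_shell_right (g := fun t => g (-t)) hhom hconv
    (hc.comp continuous_neg.continuousOn fun t ht => ht) h12 h23 h34 (fun t ht hgt => ?_)
    (fun t ht h1 h2 => ?_) (by simpa using ht₀) (fun t ht => ?_) (by simpa using hlt)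
  · have h := hint (-t) ht hgt
    exact preimage_interior_subset_interior_preimage continuous_neg h
  · exact (hd (-t) ht h1 h2).comp t differentiable_neg.differentiableAt
  · simpa using hmin ht

/-- The variations of a convex function of one variable on two consecutive shells. Both bounds come
twice, once for each side of a minimizer, unless the minimum is at least `c₂`, in which case the
derivative vanishes on the inner shell. -/
theorem ConvexOn.lintegral_abs_deriv_shell_le {g : ℝ → ℝ} {I : Set ℝ} (hI : IsCompact I)
    (hg : ConvexOn ℝ I g) (hc : ContinuousOn g I) {c₁ c₂ c₃ c₄ : ℝ} (h12 : c₁ < c₂) (h23 : c₂ < c₃)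
    (h34 : c₃ < c₄) (hint : ∀ t ∈ I, g t < c₄ → t ∈ interior I)
    (hd : ∀ t ∈ I, c₁ < g t → g t < c₄ → DifferentiableAt ℝ g t) :
    ENNReal.ofReal (c₃ - c₂) *
        ∫⁻ t in {t | t ∈ I ∧ c₁ < g t ∧ g t ≤ c₂}, ENNReal.ofReal |deriv g t| ≤
      ENNReal.ofReal (c₂ - c₁) *
        ∫⁻ t in {t | t ∈ I ∧ c₂ < g t ∧ g t ≤ c₃}, ENNReal.ofReal |deriv g t| := by
  by_cases hex : ∃ s ∈ I, g s < c₂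
  · obtain ⟨s, hsI, hs⟩ := hex
    obtain ⟨t₀, ht₀, hmin⟩ := hI.exists_isMinOn ⟨s, hsI⟩ hc
    have hlt : g t₀ < c₂ := (hmin hsI).trans_lt hs
    obtain ⟨hr1, hr2⟩ := hg.lintegral_abs_deriv_shell_right hI hc h12 h23 h34 hint hd ht₀ hmin hlt
    obtain ⟨hl1, hl2⟩ := hg.lintegral_abs_deriv_shell_left hI hc h12 h23 h34 hint hd ht₀ hmin hlt
    have hsplit : ∀ S : Set ℝ, ∫⁻ t in S, ENNReal.ofReal |deriv g t| =
        (∫⁻ t in S ∩ Ioi t₀, ENNReal.ofReal |deriv g t|) +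
          ∫⁻ t in S ∩ Iio t₀, ENNReal.ofReal |deriv g t| := by
      intro S
      rw [← lintegral_inter_add_sdiff (μ := volume) (fun t => ENNReal.ofReal |deriv g t|) S
        (measurableSet_Ioi (a := t₀))]
      congr 1
      refine setLIntegral_congr ?_
      have h : (S \ Ioi t₀ : Set ℝ) = S ∩ Iic t₀ := by
        ext t; simp
      rw [h]
      exact (Filter.EventuallyEq.refl _ S).inter Iio_ae_eq_Iic.symm
    rw [hsplit {t | t ∈ I ∧ c₁ < g t ∧ g t ≤ c₂}, hsplit {t | t ∈ I ∧ c₂ < g t ∧ g t ≤ c₃}]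
    calc _ ≤ ENNReal.ofReal (c₃ - c₂) * (ENNReal.ofReal (c₂ - c₁) + ENNReal.ofReal (c₂ - c₁)) := by
          gcongr
      _ = ENNReal.ofReal (c₂ - c₁) * (ENNReal.ofReal (c₃ - c₂) + ENNReal.ofReal (c₃ - c₂)) := by
          ring
      _ ≤ _ := by gcongr
  · push Not at hex
    -- on this shell `g` takes its minimal value
    have hz : ∀ t ∈ {t | t ∈ I ∧ c₁ < g t ∧ g t ≤ c₂}, ENNReal.ofReal |deriv g t| = 0 := by
      intro t ht
      have hgt : g t = c₂ := le_antisymm ht.2.2 (hex t ht.1)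
      have hloc : IsLocalMin g t := by
        filter_upwards [mem_interior_iff_mem_nhds.1 (hint t ht.1 (by linarith))] with s hs
        rw [hgt]; exact hex s hs
      simp [hloc.deriv_eq_zero]
    have : ∫⁻ t in {t | t ∈ I ∧ c₁ < g t ∧ g t ≤ c₂}, ENNReal.ofReal |deriv g t| = 0 := by
      refine le_antisymm ?_ (zero_le)
      calc _ ≤ ∫⁻ t in {t | t ∈ I ∧ c₁ < g t ∧ g t ≤ c₂}, 0 :=
            setLIntegral_mono' ?_ fun t ht => (hz t ht).le
        _ = 0 := by simp
      have h1 : {t | t ∈ I ∧ c₁ < g t ∧ g t ≤ c₂} = I ∩ g ⁻¹' Iic c₂ := by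
        ext t
        exact ⟨fun h => ⟨h.1, h.2.2⟩, fun h => ⟨h.1, h12.trans_le (hex t h.1), h.2⟩⟩
      rw [h1]
      exact (hc.preimage_isClosed_of_isClosed hI.isClosed isClosed_Iic).measurableSet
    rw [this, mul_zero]
    exact zero_le

end Line

/-! ### Volumes of shells of a convex function -/

section ShellVolume

open MeasureTheory Set Metric
open scoped RealInnerProductSpace Gradient

theorem ContinuousOn.measurableSet_shell {X : Type*} [TopologicalSpace X] [MeasurableSpace X]
    [OpensMeasurableSpace X] {D : Set X} (hD : IsClosed D) {f : X → ℝ}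
    (hc : ContinuousOn f D) (a b : ℝ) : MeasurableSet {x | x ∈ D ∧ a < f x ∧ f x ≤ b} := by
  have h : {x | x ∈ D ∧ a < f x ∧ f x ≤ b} = (D ∩ f ⁻¹' Iic b) \ (D ∩ f ⁻¹' Iic a) := by
    ext x
    simp only [mem_ofPred_eq, mem_sdiff, mem_inter_iff, mem_preimage, mem_Iic, not_and, not_le]
    tauto
  rw [h]
  exact (hc.preimage_isClosed_of_isClosed hD isClosed_Iic).measurableSet.diff
    (hc.preimage_isClosed_of_isClosed hD isClosed_Iic).measurableSet

variable {E : Type*} [NormedAddCommGroup E] [InnerProductSpace ℝ E] [FiniteDimensional ℝ E]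
  [MeasurableSpace E] [BorelSpace E]

/-- Fubini for the lines in the direction of a unit vector `v`. -/
theorem lintegral_eq_lintegral_orthogonal_lintegral_line {v : E} (hv : ‖v‖ = 1)
    {F : E → ENNReal} (hF : Measurable F) :
    ∫⁻ x, F x = ∫⁻ y : (ℝ ∙ v)ᗮ, ∫⁻ t : ℝ, F ((y : E) + t • v) := by
  have hmp := ((ℝ ∙ v).measurePreserving_measurableEquivProd (0 : E)).symm
  rw [InnerProductSpace.euclideanHausdorffMeasure_eq_volume] at hmp
  have hmp2 := (LinearIsometryEquiv.toSpanUnitSingleton v hv).measurePreserving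
  rw [← hmp.lintegral_comp hF, Measure.volume_eq_prod, lintegral_prod_symm
    (fun p => F (((ℝ ∙ v).measurableEquivProd (0 : E)).symm p))
    (hF.comp (MeasurableEquiv.measurable _)).aemeasurable]
  refine lintegral_congr fun y => ?_
  rw [← hmp2.lintegral_comp_emb
    (LinearIsometryEquiv.toSpanUnitSingleton v hv).toHomeomorph.measurableEmbedding]
  refine lintegral_congr fun t => ?_
  simp [add_comm]

/-- The first absolute moment of `⟪g, ·⟫` on the unit ball is proportional to `‖g‖`. -/
theorem exists_lintegral_ball_abs_inner_eq [Nontrivial E] : ∃ κ : ENNReal, κ ≠ 0 ∧ κ ≠ ⊤ ∧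
    ∀ g : E, ∫⁻ v in ball (0 : E) 1, ENNReal.ofReal |⟪g, v⟫| = ENNReal.ofReal ‖g‖ * κ := by
  obtain ⟨e, he⟩ := exists_norm_eq E zero_le_one
  have hcont : ∀ g : E, Continuous fun v : E => ENNReal.ofReal |⟪g, v⟫| := fun g =>
    ENNReal.continuous_ofReal.comp (continuous_const.inner continuous_id).abs
  refine ⟨∫⁻ v in ball (0 : E) 1, ENNReal.ofReal |⟪e, v⟫|, ?_, ?_, fun g => ?_⟩
  · intro h0
    have h1 : 0 < ∫⁻ v in ball ((1 / 2 : ℝ) • e) (1 / 2), ENNReal.ofReal |⟪e, v⟫| := by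
      refine (setLIntegral_pos_iff (hcont e).measurable).2 ?_
      have hsub : ball ((1 / 2 : ℝ) • e) (1 / 2) ⊆
          Function.support (fun v : E => ENNReal.ofReal |⟪e, v⟫|) := by
        intro v hv
        rw [mem_ball, dist_eq_norm] at hv
        have h2 : ⟪e, v⟫ = 1 / 2 + ⟪e, v - (1 / 2 : ℝ) • e⟫ := by
          rw [inner_sub_right, real_inner_smul_right, real_inner_self_eq_norm_sq, he]; ring
        have h3 := abs_real_inner_le_norm e (v - (1 / 2 : ℝ) • e)
        rw [he, one_mul] at h3
        have h4 := neg_le_of_abs_le h3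
        have h5 : 0 < ⟪e, v⟫ := by linarith
        simpa using h5.ne'
      rw [inter_eq_self_of_subset_right hsub]
      exact measure_ball_pos _ _ (by norm_num)
    refine absurd (h1.trans_le (lintegral_mono_set fun v hv => ?_)) (by rw [h0]; exact lt_irrefl _)
    rw [mem_ball, dist_eq_norm] at hv
    have h6 : ‖(1 / 2 : ℝ) • e‖ = 1 / 2 := by rw [norm_smul, he]; norm_num
    rw [mem_ball_zero_iff]
    have := norm_le_norm_add_norm_sub ((1 / 2 : ℝ) • e) v
    rw [norm_sub_rev] at this
    linarith
  · refine ne_of_lt ?_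
    calc ∫⁻ v in ball (0 : E) 1, ENNReal.ofReal |⟪e, v⟫|
        ≤ ∫⁻ v in ball (0 : E) 1, 1 := by
          refine setLIntegral_mono' measurableSet_ball fun v hv => ?_
          rw [← ENNReal.ofReal_one]
          refine ENNReal.ofReal_le_ofReal ((abs_real_inner_le_norm e v).trans ?_)
          rw [he, one_mul]
          exact (mem_ball_zero_iff.1 hv).le
      _ < ⊤ := by simpa using measure_ball_lt_top
  · rcases eq_or_ne g 0 with rfl | hg
    · simp
    have hg0 : 0 < ‖g‖ := norm_pos_iff.2 hg
    let R : E ≃ₗᵢ[ℝ] E := (ℝ ∙ (e - ‖g‖⁻¹ • g))ᗮ.reflection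
    have hR : R e = ‖g‖⁻¹ • g := Submodule.reflection_sub (by
      rw [he, norm_smul, norm_inv, norm_norm, inv_mul_cancel₀ hg0.ne'])
    have hgR : g = ‖g‖ • R e := by rw [hR, smul_inv_smul₀ hg0.ne']
    have h7 : ∫⁻ v in ball (0 : E) 1, ENNReal.ofReal |⟪R e, v⟫| =
        ∫⁻ v in ball (0 : E) 1, ENNReal.ofReal |⟪e, v⟫| := by
      rw [← R.measurePreserving.setLIntegral_comp_preimage_emb
        R.toHomeomorph.measurableEmbedding (fun v => ENNReal.ofReal |⟪R e, v⟫|)]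
      have : R ⁻¹' ball (0 : E) 1 = ball 0 1 := by
        ext v; simp
      rw [this]
      simp only [LinearIsometryEquiv.inner_map_map]
    rw [← h7, ← lintegral_const_mul _ (hcont _).measurable]
    refine lintegral_congr fun v => ?_
    conv_lhs => rw [hgR]
    rw [real_inner_smul_left, abs_mul, abs_of_pos hg0, ENNReal.ofReal_mul hg0.le]

theorem ConvexOn.lintegral_abs_inner_gradient_shell_le_of_norm_eq_one {D : Set E}
    (hD : IsCompact D) {f : E → ℝ} (hf : ConvexOn ℝ D f) (hc : ContinuousOn f D)
    {c₁ c₂ c₃ c₄ : ℝ} (h12 : c₁ < c₂) (h23 : c₂ < c₃) (h34 : c₃ < c₄)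
    (hint : ∀ x ∈ D, f x < c₄ → x ∈ interior D)
    (hd : ∀ x ∈ D, c₁ < f x → f x < c₄ → DifferentiableAt ℝ f x) {v : E} (hv : ‖v‖ = 1) :
    ENNReal.ofReal (c₃ - c₂) *
        ∫⁻ x in {x | x ∈ D ∧ c₁ < f x ∧ f x ≤ c₂}, ENNReal.ofReal |⟪∇ f x, v⟫| ≤
      ENNReal.ofReal (c₂ - c₁) *
        ∫⁻ x in {x | x ∈ D ∧ c₂ < f x ∧ f x ≤ c₃}, ENNReal.ofReal |⟪∇ f x, v⟫| := by
  have hmeas : Measurable fun x => ENNReal.ofReal |⟪∇ f x, v⟫| := by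
    simp only [inner_gradient_left]
    exact ((measurable_fderiv_apply_const ℝ f v).abs).ennreal_ofReal
  have hline : ∀ y : E, ∀ a b : ℝ, c₁ ≤ a → b < c₄ →
      ∫⁻ t : ℝ, {x | x ∈ D ∧ a < f x ∧ f x ≤ b}.indicator
          (fun x => ENNReal.ofReal |⟪∇ f x, v⟫|) (y + t • v) =
        ∫⁻ t in {t | t ∈ {t : ℝ | y + t • v ∈ D} ∧ a < f (y + t • v) ∧ f (y + t • v) ≤ b},
          ENNReal.ofReal |deriv (fun t : ℝ => f (y + t • v)) t| := by
    intro y a b ha hb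
    have hms : MeasurableSet
        {t | t ∈ {t : ℝ | y + t • v ∈ D} ∧ a < f (y + t • v) ∧ f (y + t • v) ≤ b} :=
      (hc.measurableSet_shell hD.isClosed a b).preimage
        (measurable_const.add (measurable_id.smul_const v))
    rw [← lintegral_indicator hms]
    refine lintegral_congr fun t => ?_
    by_cases ht : y + t • v ∈ D ∧ a < f (y + t • v) ∧ f (y + t • v) ≤ b
    · rw [indicator_of_mem (show y + t • v ∈ {x | x ∈ D ∧ a < f x ∧ f x ≤ b} from ht),
        indicator_of_mem (show t ∈ {t | t ∈ {t : ℝ | y + t • v ∈ D} ∧ a < f (y + t • v) ∧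
          f (y + t • v) ≤ b} from ht)]
      have h1 := (hd _ ht.1 (ha.trans_lt ht.2.1) (ht.2.2.trans_lt hb)).hasFDerivAt
      have h2 : HasDerivAt (fun t : ℝ => y + t • v) v t := by
        simpa using ((hasDerivAt_id t).smul_const v).const_add y
      have h3 : deriv (fun t : ℝ => f (y + t • v)) t = fderiv ℝ f (y + t • v) v :=
        (h1.comp_hasDerivAt t h2).deriv
      rw [h3, inner_gradient_left]
    · rw [indicator_of_notMem (show y + t • v ∉ {x | x ∈ D ∧ a < f x ∧ f x ≤ b} from ht),
        indicator_of_notMem (show t ∉ {t | t ∈ {t : ℝ | y + t • v ∈ D} ∧ a < f (y + t • v) ∧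
          f (y + t • v) ≤ b} from ht)]
  have hm : ∀ a b : ℝ, Measurable ({x | x ∈ D ∧ a < f x ∧ f x ≤ b}.indicator
      fun x => ENNReal.ofReal |⟪∇ f x, v⟫|) := fun a b =>
    hmeas.indicator (hc.measurableSet_shell hD.isClosed a b)
  rw [← lintegral_indicator (hc.measurableSet_shell hD.isClosed c₁ c₂),
    ← lintegral_indicator (hc.measurableSet_shell hD.isClosed c₂ c₃),
    lintegral_eq_lintegral_orthogonal_lintegral_line hv (hm c₁ c₂),
    lintegral_eq_lintegral_orthogonal_lintegral_line hv (hm c₂ c₃),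
    ← lintegral_const_mul' _ _ ENNReal.ofReal_ne_top,
    ← lintegral_const_mul' _ _ ENNReal.ofReal_ne_top]
  refine lintegral_mono fun y => ?_
  change ENNReal.ofReal (c₃ - c₂) * _ ≤ ENNReal.ofReal (c₂ - c₁) * _
  rw [hline y c₁ c₂ le_rfl (h23.trans h34), hline y c₂ c₃ h12.le h34]
  have hisom : Isometry fun t : ℝ => (y : E) + t • v := Isometry.of_dist_eq fun s t => by
    rw [dist_add_left, dist_eq_norm, ← sub_smul, norm_smul, hv, mul_one, Real.dist_eq,
      Real.norm_eq_abs]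
  have hcont := hisom.continuous
  have hconv : ConvexOn ℝ {t : ℝ | (y : E) + t • v ∈ D} fun t : ℝ => f (y + t • v) := by
    have := hf.comp_affineMap (AffineMap.lineMap (y : E) ((y : E) + v) : ℝ →ᵃ[ℝ] E)
    have h : ⇑(AffineMap.lineMap (y : E) ((y : E) + v) : ℝ →ᵃ[ℝ] E) = fun t => (y : E) + t • v := by
      ext1 t
      simp [AffineMap.lineMap_apply, add_comm]
    rw [h] at this
    exact this
  refine hconv.lintegral_abs_deriv_shell_le (hisom.isClosedEmbedding.isCompact_preimage hD)
    (hc.comp hcont.continuousOn fun t ht => ht) h12 h23 h34 (fun t ht hlt => ?_)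
    fun t ht h1 h2 => ?_
  · exact preimage_interior_subset_interior_preimage hcont (hint _ ht hlt)
  · exact (hd _ ht h1 h2).comp t ((differentiableAt_id.smul_const v).const_add _)

theorem ConvexOn.lintegral_abs_inner_gradient_shell_le {D : Set E}
    (hD : IsCompact D) {f : E → ℝ} (hf : ConvexOn ℝ D f) (hc : ContinuousOn f D)
    {c₁ c₂ c₃ c₄ : ℝ} (h12 : c₁ < c₂) (h23 : c₂ < c₃) (h34 : c₃ < c₄)
    (hint : ∀ x ∈ D, f x < c₄ → x ∈ interior D)
    (hd : ∀ x ∈ D, c₁ < f x → f x < c₄ → DifferentiableAt ℝ f x) (v : E) :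
    ENNReal.ofReal (c₃ - c₂) *
        ∫⁻ x in {x | x ∈ D ∧ c₁ < f x ∧ f x ≤ c₂}, ENNReal.ofReal |⟪∇ f x, v⟫| ≤
      ENNReal.ofReal (c₂ - c₁) *
        ∫⁻ x in {x | x ∈ D ∧ c₂ < f x ∧ f x ≤ c₃}, ENNReal.ofReal |⟪∇ f x, v⟫| := by
  rcases eq_or_ne v 0 with rfl | hv
  · simp
  have hv0 : 0 < ‖v‖ := norm_pos_iff.2 hv
  have hscale : ∀ S : Set E, ∫⁻ x in S, ENNReal.ofReal |⟪∇ f x, v⟫| =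
      ENNReal.ofReal ‖v‖ * ∫⁻ x in S, ENNReal.ofReal |⟪∇ f x, ‖v‖⁻¹ • v⟫| := by
    intro S
    rw [← lintegral_const_mul' _ _ ENNReal.ofReal_ne_top]
    refine lintegral_congr fun x => ?_
    rw [← ENNReal.ofReal_mul hv0.le, real_inner_smul_right, abs_mul,
      abs_of_pos (inv_pos.2 hv0), mul_inv_cancel_left₀ hv0.ne']
  rw [hscale, hscale, mul_left_comm, mul_left_comm (ENNReal.ofReal (c₂ - c₁))]
  gcongr ENNReal.ofReal ‖v‖ * ?_
  exact hf.lintegral_abs_inner_gradient_shell_le_of_norm_eq_one hD hc h12 h23 h34 hint hd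
    (by rw [norm_smul, norm_inv, norm_norm, inv_mul_cancel₀ hv0.ne'])

/-- The integrals of `‖∇ f‖` over two consecutive shells, compared by averaging the inequality for
directional derivatives over all directions. -/
theorem ConvexOn.lintegral_norm_gradient_shell_le [Nontrivial E] {D : Set E}
    (hD : IsCompact D) {f : E → ℝ} (hf : ConvexOn ℝ D f) (hc : ContinuousOn f D)
    {c₁ c₂ c₃ c₄ : ℝ} (h12 : c₁ < c₂) (h23 : c₂ < c₃) (h34 : c₃ < c₄)
    (hint : ∀ x ∈ D, f x < c₄ → x ∈ interior D)
    (hd : ∀ x ∈ D, c₁ < f x → f x < c₄ → DifferentiableAt ℝ f x) :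
    ENNReal.ofReal (c₃ - c₂) *
        ∫⁻ x in {x | x ∈ D ∧ c₁ < f x ∧ f x ≤ c₂}, ENNReal.ofReal ‖∇ f x‖ ≤
      ENNReal.ofReal (c₂ - c₁) *
        ∫⁻ x in {x | x ∈ D ∧ c₂ < f x ∧ f x ≤ c₃}, ENNReal.ofReal ‖∇ f x‖ := by
  obtain ⟨κ, hκ0, hκtop, hκ⟩ := exists_lintegral_ball_abs_inner_eq (E := E)
  have hjoint : Measurable fun p : E × E => ENNReal.ofReal |⟪∇ f p.1, p.2⟫| := by
    simp only [inner_gradient_left]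
    have h := (isBoundedBilinearMap_apply (𝕜 := ℝ) (E := E) (F := ℝ)).continuous.measurable
    exact ((h.comp (((measurable_fderiv ℝ f).comp measurable_fst).prodMk
      measurable_snd)).abs).ennreal_ofReal
  have hswap : ∀ S : Set E, (∫⁻ x in S, ENNReal.ofReal ‖∇ f x‖) * κ =
      ∫⁻ v in ball (0 : E) 1, ∫⁻ x in S, ENNReal.ofReal |⟪∇ f x, v⟫| := by
    intro S
    rw [← lintegral_mul_const' _ _ hκtop, lintegral_lintegral_swap
      (f := fun v x => ENNReal.ofReal |⟪∇ f x, v⟫|) (hjoint.comp measurable_swap).aemeasurable]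
    exact lintegral_congr fun x => (hκ _).symm
  rw [← ENNReal.mul_le_mul_iff_left hκ0 hκtop, mul_assoc, mul_assoc, hswap, hswap,
    ← lintegral_const_mul' _ _ ENNReal.ofReal_ne_top,
    ← lintegral_const_mul' _ _ ENNReal.ofReal_ne_top]
  exact lintegral_mono fun v =>
    hf.lintegral_abs_inner_gradient_shell_le hD hc h12 h23 h34 hint hd v

/-- The volume of an inner shell of a convex function, compared with that of an outer shell by
means of the bounds `k ≤ ‖∇ f‖ ≤ K`. -/
theorem ConvexOn.measureReal_shell_le [Nontrivial E] {D : Set E}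
    (hD : IsCompact D) {f : E → ℝ} (hf : ConvexOn ℝ D f) {K : ℝ≥0} (hK : LipschitzOnWith K f D)
    {k : ℝ} (hk : 0 < k)
    {c₁ c₂ c₃ c₄ : ℝ} (h12 : c₁ < c₂) (h23 : c₂ < c₃) (h34 : c₃ < c₄)
    (hint : ∀ x ∈ D, f x < c₄ → x ∈ interior D)
    (hd : ∀ x ∈ D, c₁ < f x → f x < c₄ → DifferentiableAt ℝ f x ∧ k ≤ ‖∇ f x‖) :
    (c₃ - c₂) * k * volume.real {x | x ∈ D ∧ c₁ < f x ∧ f x ≤ c₂} ≤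
      (c₂ - c₁) * K * volume.real {x | x ∈ D ∧ c₂ < f x ∧ f x ≤ c₃} := by
  have hc := hK.continuousOn
  have hfin : ∀ a b : ℝ, volume {x | x ∈ D ∧ a < f x ∧ f x ≤ b} ≠ ⊤ := fun a b =>
    ((measure_mono fun x hx => hx.1).trans_lt hD.measure_lt_top).ne
  have h := hf.lintegral_norm_gradient_shell_le hD hc h12 h23 h34 hint
    fun x hx h1 h2 => (hd x hx h1 h2).1
  have hlow : ENNReal.ofReal k * volume {x | x ∈ D ∧ c₁ < f x ∧ f x ≤ c₂} ≤
      ∫⁻ x in {x | x ∈ D ∧ c₁ < f x ∧ f x ≤ c₂}, ENNReal.ofReal ‖∇ f x‖ := by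
    rw [← setLIntegral_const]
    exact setLIntegral_mono' (hc.measurableSet_shell hD.isClosed _ _) fun x hx =>
      ENNReal.ofReal_le_ofReal (hd x hx.1 hx.2.1 (by linarith [hx.2.2])).2
  have hup : ∫⁻ x in {x | x ∈ D ∧ c₂ < f x ∧ f x ≤ c₃}, ENNReal.ofReal ‖∇ f x‖ ≤
      ENNReal.ofReal K * volume {x | x ∈ D ∧ c₂ < f x ∧ f x ≤ c₃} := by
    rw [← setLIntegral_const]
    refine setLIntegral_mono' (hc.measurableSet_shell hD.isClosed _ _) fun x hx =>
      ENNReal.ofReal_le_ofReal ?_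
    have h1 : ‖∇ f x‖ = ‖fderiv ℝ f x‖ := by
      rw [← toDual_gradient, LinearIsometryEquiv.norm_map]
    rw [h1]
    exact norm_fderiv_le_of_lipschitzOn ℝ
      (mem_interior_iff_mem_nhds.1 (hint x hx.1 (by linarith [hx.2.2]))) hK
  have h2 : ENNReal.ofReal (c₃ - c₂) * (ENNReal.ofReal k *
      volume {x | x ∈ D ∧ c₁ < f x ∧ f x ≤ c₂}) ≤ ENNReal.ofReal (c₂ - c₁) * (ENNReal.ofReal K *
      volume {x | x ∈ D ∧ c₂ < f x ∧ f x ≤ c₃}) :=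
    (mul_le_mul_right hlow _).trans (h.trans (mul_le_mul_right hup _))
  have h3 := ENNReal.toReal_mono (by finiteness [hfin c₂ c₃]) h2
  simp only [ENNReal.toReal_mul, ENNReal.toReal_ofReal (sub_nonneg.2 h23.le),
    ENNReal.toReal_ofReal (sub_nonneg.2 h12.le), ENNReal.toReal_ofReal hk.le,
    ENNReal.toReal_ofReal K.coe_nonneg] at h3
  simpa only [mul_assoc, Measure.real] using h3

end ShellVolume

/-! ### Paths in a uniform grid, boxes, and the gradient inequality -/

section Lattice

open MeasureTheory Set
open scoped RealInnerProductSpace Gradient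

variable {d : ℕ}

theorem EuclideanSpace.norm_le_sqrt_mul_of_abs_le {x : EuclideanSpace ℝ (Fin d)} {ρ : ℝ}
    (hρ : 0 ≤ ρ) (hx : ∀ i, |x i| ≤ ρ) : ‖x‖ ≤ Real.sqrt d * ρ := by
  have h1 : ∑ i, ‖x i‖ ^ 2 ≤ d * ρ ^ 2 := by
    calc ∑ i, ‖x i‖ ^ 2 ≤ ∑ _i : Fin d, ρ ^ 2 := Finset.sum_le_sum fun i _ => by
          rw [Real.norm_eq_abs]; exact pow_le_pow_left₀ (abs_nonneg _) (hx i) 2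
      _ = d * ρ ^ 2 := by simp
  rw [EuclideanSpace.norm_eq]
  calc Real.sqrt (∑ i, ‖x i‖ ^ 2) ≤ Real.sqrt (d * ρ ^ 2) := Real.sqrt_le_sqrt h1
    _ = Real.sqrt d * ρ := by rw [Real.sqrt_mul (by positivity), Real.sqrt_sq hρ]

/-- A grid which contains a point `x` next to the segment from `s` to `y` contains all points
congruent to `x` on the way to `y`: rounding the points of the segment gives a chain of unit steps
from `x` to `y`. -/
theorem IsUniformGrid.mem_of_forall_add_mul {δ : ℝ} (hδ : 0 < δ)
    {D : Set (EuclideanSpace ℝ (Fin d))} {P : Finset (EuclideanSpace ℝ (Fin d))}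
    (hP : IsUniformGrid δ D P) {S : Set (EuclideanSpace ℝ (Fin d))} (hS : Convex ℝ S)
    (hSD : ∀ s ∈ S, ∀ u : EuclideanSpace ℝ (Fin d), (∀ i, |u i - s i| ≤ δ / 2) → u ∈ D)
    {y : EuclideanSpace ℝ (Fin d)} (hy : y ∈ S) :
    ∀ (n : ℕ) (x s : EuclideanSpace ℝ (Fin d)) (z : Fin d → ℤ), ∑ i, (z i).natAbs = n →
      x ∈ P → s ∈ S → (∀ i, |x i - s i| ≤ δ / 2) → (∀ i, y i = x i + δ * z i) → y ∈ P := by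
  intro n
  induction n using Nat.strong_induction_on with
  | _ n ih =>
  intro x s z hn hx hs hxs hyz
  rcases (Finset.univ.filter fun i => z i ≠ 0).eq_empty_or_nonempty with hemp | hne
  · have hz : ∀ i, z i = 0 := fun i => by
      by_contra h
      have : i ∈ Finset.univ.filter fun i => z i ≠ 0 := by simpa using h
      rw [hemp] at this
      simp at this
    have : y = x := by
      ext i
      simp [hyz i, hz i]
    rwa [this]
  -- `τ i` is the time at which coordinate `i` of the moving point is to be rounded anew
  let σ : Fin d → ℝ := fun i => ((z i).sign : ℝ)
  let a : Fin d → ℝ := fun i => σ i * (s i - x i)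
  let τ : Fin d → ℝ := fun i => (δ / 2 - a i) / (δ * |(z i : ℝ)| - a i)
  obtain ⟨i, hi, hmin⟩ := Finset.exists_min_image _ τ hne
  have hact : ∀ j, z j ≠ 0 → |σ j| = 1 ∧ σ j * σ j = 1 ∧ σ j * z j = |(z j : ℝ)| ∧
      1 ≤ |(z j : ℝ)| := by
    intro j hj
    have h1 : (1 : ℝ) ≤ |(z j : ℝ)| := by
      exact_mod_cast Int.one_le_abs hj
    rcases lt_or_gt_of_ne hj with h | h
    · have h' : (z j : ℝ) < 0 := by exact_mod_cast h
      simp only [σ, Int.sign_eq_neg_one_of_neg h]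
      refine ⟨by norm_num, by norm_num, ?_, h1⟩
      rw [abs_of_neg h']; push_cast; ring
    · have h' : (0 : ℝ) < z j := by exact_mod_cast h
      simp only [σ, Int.sign_eq_one_of_pos h]
      refine ⟨by norm_num, by norm_num, ?_, h1⟩
      rw [abs_of_pos h']; push_cast; ring
  have ha : ∀ j, z j ≠ 0 → |a j| ≤ δ / 2 := fun j hj => by
    rw [abs_mul, (hact j hj).1, one_mul, abs_sub_comm]; exact hxs j
  have hden : ∀ j, z j ≠ 0 → 0 < δ * |(z j : ℝ)| - a j := fun j hj => by
    have h1 := (abs_le.1 (ha j hj)).2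
    nlinarith [(hact j hj).2.2.2]
  have hi0 : z i ≠ 0 := by simpa using hi
  have hτ0 : 0 ≤ τ i := div_nonneg (by linarith [(abs_le.1 (ha i hi0)).2]) (hden i hi0).le
  have hτ1 : τ i ≤ 1 := by
    rw [div_le_one (hden i hi0)]
    nlinarith [(hact i hi0).2.2.2]
  set s' : EuclideanSpace ℝ (Fin d) := (1 - τ i) • s + τ i • y with hs'
  have hs'S : s' ∈ S := hS hs hy (by linarith) hτ0 (by ring)
  have hs'j : ∀ j, s' j - x j = (1 - τ i) * (s j - x j) + τ i * (δ * z j) := fun j => by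
    simp only [hs', PiLp.add_apply, PiLp.smul_apply, smul_eq_mul, hyz j]; ring
  have hσj : ∀ j, z j ≠ 0 → σ j * (s' j - x j) = a j + τ i * (δ * |(z j : ℝ)| - a j) := by
    intro j hj
    rw [hs'j, ← (hact j hj).2.2.1]
    simp only [a]; ring
  have hclose : ∀ j, |x j - s' j| ≤ δ / 2 := by
    intro j
    rw [abs_sub_comm]
    by_cases hj : z j = 0
    · rw [hs'j, hj, Int.cast_zero, mul_zero, mul_zero, add_zero, abs_mul, abs_sub_comm (s j),
        abs_of_nonneg (by linarith : (0 : ℝ) ≤ 1 - τ i)]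
      exact (mul_le_of_le_one_left (abs_nonneg _) (by linarith)).trans (hxs j)
    · have h1 : |s' j - x j| = |σ j * (s' j - x j)| := by
        rw [abs_mul, (hact j hj).1, one_mul]
      rw [h1, hσj j hj]
      have h2 : τ i ≤ τ j := hmin j (by simpa using hj)
      have h3 : τ j * (δ * |(z j : ℝ)| - a j) = δ / 2 - a j := div_mul_cancel₀ _ (hden j hj).ne'
      have h4 := mul_le_mul_of_nonneg_right h2 (hden j hj).le
      have h5 := mul_nonneg hτ0 (hden j hj).le
      have h6 := (abs_le.1 (ha j hj)).1
      rw [abs_le]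
      constructor <;> linarith
  have hσi : σ i * (s' i - x i) = δ / 2 := by
    rw [hσj i hi0, div_mul_cancel₀ _ (hden i hi0).ne']; ring
  let x' : EuclideanSpace ℝ (Fin d) := x + (σ i * δ) • EuclideanSpace.single i (1 : ℝ)
  have hx'j : ∀ j, x' j = x j + if j = i then σ i * δ else 0 := fun j => by
    simp [x']
  have hclose' : ∀ j, |x' j - s' j| ≤ δ / 2 := by
    intro j
    rw [hx'j]
    by_cases hj : j = i
    · subst hj
      have h1 : x j + σ j * δ - s' j = σ j * (δ / 2) := by
        have h2 : s' j - x j = σ j * (δ / 2) := by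
          rw [← hσi, ← mul_assoc, (hact j hi0).2.1, one_mul]
        linear_combination -h2
      rw [if_pos rfl, h1, abs_mul, (hact j hi0).1, one_mul, abs_of_pos (by positivity)]
    · rw [if_neg hj, add_zero]; exact hclose j
  have hx'D : x' ∈ D := hSD s' hs'S x' hclose'
  have hx'P : x' ∈ P := by
    rcases lt_or_gt_of_ne hi0 with h | h
    · have hσ : σ i = -1 := by simp [σ, Int.sign_eq_neg_one_of_neg h]
      have hx' : x' = x - δ • EuclideanSpace.single i (1 : ℝ) := by
        simp only [x', hσ, neg_mul, one_mul, neg_smul, sub_eq_add_neg]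
      rw [hx'] at hx'D ⊢
      exact hP.step_sub x hx i hx'D
    · have hσ : σ i = 1 := by simp [σ, Int.sign_eq_one_of_pos h]
      have hx' : x' = x + δ • EuclideanSpace.single i (1 : ℝ) := by
        simp only [x', hσ, one_mul]
      rw [hx'] at hx'D ⊢
      exact hP.step_add x hx i hx'D
  refine ih (∑ j, (Function.update z i (z i - (z i).sign) j).natAbs) ?_ x' s'
    (Function.update z i (z i - (z i).sign)) rfl hx'P hs'S hclose' fun j => ?_
  · rw [← hn]
    refine Finset.sum_lt_sum (fun j _ => ?_) ⟨i, Finset.mem_univ _, ?_⟩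
    · by_cases hj : j = i
      · subst hj
        rw [Function.update_self]
        rcases lt_or_gt_of_ne hi0 with h | h
        · rw [Int.sign_eq_neg_one_of_neg h]; omega
        · rw [Int.sign_eq_one_of_pos h]; omega
      · rw [Function.update_of_ne hj]
    · rw [Function.update_self]
      rcases lt_or_gt_of_ne hi0 with h | h
      · rw [Int.sign_eq_neg_one_of_neg h]; omega
      · rw [Int.sign_eq_one_of_pos h]; omega
  · rw [hyz j, hx'j]
    by_cases hj : j = i
    · subst hj
      simp only [if_true, Function.update_self, σ]
      push_cast
      ring
    · rw [if_neg hj, Function.update_of_ne hj, add_zero]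

theorem EuclideanSpace.volume_real_box {a b : Fin d → ℝ} (hab : a ≤ b) :
    volume.real {u : EuclideanSpace ℝ (Fin d) | ∀ i, u i ∈ Ioo (a i) (b i)} =
      ∏ i, (b i - a i) := by
  have h := (PiLp.volume_preserving_ofLp (Fin d)).measure_preimage
    (MeasurableSet.univ_pi fun i => measurableSet_Ioo (a := a i) (b := b i)).nullMeasurableSet
  rw [Measure.real, ← Real.volume_pi_Ioo_toReal hab, ← h]
  congr 2
  ext u
  simp

theorem EuclideanSpace.volume_real_closed_box {a b : Fin d → ℝ} (hab : a ≤ b) :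
    volume.real {u : EuclideanSpace ℝ (Fin d) | ∀ i, u i ∈ Icc (a i) (b i)} =
      ∏ i, (b i - a i) := by
  have h := (PiLp.volume_preserving_ofLp (Fin d)).measure_preimage
    (measurableSet_Icc (a := a) (b := b)).nullMeasurableSet
  rw [Measure.real, ← Real.volume_Icc_pi_toReal hab, ← h]
  congr 2
  ext u
  simp [Pi.le_def, forall_and]

theorem EuclideanSpace.measurableSet_box (a b : Fin d → ℝ) :
    MeasurableSet {u : EuclideanSpace ℝ (Fin d) | ∀ i, u i ∈ Ioo (a i) (b i)} := by
  have h := (PiLp.volume_preserving_ofLp (Fin d)).measurable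
    (MeasurableSet.univ_pi fun i => measurableSet_Ioo (a := a i) (b := b i))
  convert h using 1
  ext u
  simp

theorem ConvexOn.add_inner_gradient_le {E : Type*} [NormedAddCommGroup E]
    [InnerProductSpace ℝ E] [CompleteSpace E] {D : Set E} {f : E → ℝ} (hf : ConvexOn ℝ D f)
    {p u : E} (hp : p ∈ D) (hu : u ∈ D) (hd : DifferentiableAt ℝ f p) :
    f p + ⟪∇ f p, u - p⟫ ≤ f u := by
  have hline : ConvexOn ℝ (Icc (0 : ℝ) 1) fun t => f (AffineMap.lineMap p u t) :=
    (hf.comp_affineMap (AffineMap.lineMap p u : ℝ →ᵃ[ℝ] E)).subset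
      (fun t ht => hf.1.lineMap_mem hp hu ht) (convex_Icc 0 1)
  have hder : HasDerivAt (fun t : ℝ => f (AffineMap.lineMap p u t)) ⟪∇ f p, u - p⟫ 0 := by
    rw [inner_gradient_left]
    have h1 : HasFDerivAt f (fderiv ℝ f p) (AffineMap.lineMap p u (0 : ℝ)) := by
      simpa using hd.hasFDerivAt
    exact h1.comp_hasDerivAt (0 : ℝ) AffineMap.hasDerivAt_lineMap
  have h := hline.le_slope_of_hasDerivAt (left_mem_Icc.2 zero_le_one)
    (right_mem_Icc.2 zero_le_one) zero_lt_one hder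
  simp only [slope_def_field, AffineMap.lineMap_apply_one, AffineMap.lineMap_apply_zero] at h
  linarith

end Lattice

/-! ### Counting grid points in shells -/

section Counting

open MeasureTheory Set
open scoped RealInnerProductSpace Gradient

/-- If the values below `c₄` are taken only in the interior of `D`, then a ball about a point of
`D` on which the Lipschitz bound stays below `c₄` lies in `D`. -/
theorem LipschitzOnWith.mem_of_add_mul_dist_lt {E : Type*} [NormedAddCommGroup E] [NormedSpace ℝ E]
    {D : Set E} {f : E → ℝ} {K : ℝ≥0} (hK : LipschitzOnWith K f D) (hD : IsClosed D)
    {c₄ : ℝ} (hint : ∀ x ∈ D, f x < c₄ → x ∈ interior D) {s u : E} (hs : s ∈ D)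
    (hlt : f s + K * dist u s < c₄) : u ∈ D := by
  by_contra hu
  have hseg : ∀ z ∈ segment ℝ s u, z ∈ D → z ∈ interior D := by
    intro z hz hzD
    refine hint z hzD ?_
    have h1 := dist_add_dist_of_mem_segment hz
    have h2 := hK.dist_le_mul z hzD s hs
    rw [Real.dist_eq, dist_comm z s] at h2
    have h3 := le_of_abs_le h2
    have h4 : (K : ℝ) * dist s z ≤ K * dist u s := by
      rw [dist_comm u s]
      exact mul_le_mul_of_nonneg_left (by linarith [dist_nonneg (x := z) (y := u)]) K.2
    linarith
  obtain ⟨z, -, hz1, hz2⟩ := (convex_segment s u).isPreconnected (interior D) Dᶜ isOpen_interior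
    hD.isOpen_compl
    (fun z hz => (em (z ∈ D)).imp (hseg z hz) id)
    ⟨s, left_mem_segment ℝ s u, hseg s (left_mem_segment ℝ s u) hs⟩
    ⟨u, right_mem_segment ℝ s u, hu⟩
  exact hz2 (interior_subset hz1)

variable {d : ℕ}

/-- The class of a point modulo `δ ℤ^d`, encoded by the fractional parts of its coordinates in
units of `δ`. -/
noncomputable def latticeClass (δ : ℝ) (x : EuclideanSpace ℝ (Fin d)) : Fin d → ℝ :=
  fun i => Int.fract (x i / δ)

theorem latticeClass_eq_iff {δ : ℝ} (hδ : 0 < δ) {x y : EuclideanSpace ℝ (Fin d)} :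
    latticeClass δ x = latticeClass δ y ↔ ∃ z : Fin d → ℤ, ∀ i, y i = x i + δ * z i := by
  simp only [latticeClass, funext_iff, Int.fract_eq_fract]
  constructor
  · intro h
    choose z hz using h
    refine ⟨fun i => - z i, fun i => ?_⟩
    have := hz i
    rw [← sub_div, div_eq_iff hδ.ne'] at this
    push_cast
    linarith
  · rintro ⟨z, hz⟩ i
    refine ⟨-z i, ?_⟩
    rw [← sub_div, div_eq_iff hδ.ne', hz i]
    push_cast
    ring

theorem exists_latticeClass_eq_abs_sub_le {δ : ℝ} (hδ : 0 < δ)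
    (x v : EuclideanSpace ℝ (Fin d)) : ∃ p : EuclideanSpace ℝ (Fin d),
      latticeClass δ x = latticeClass δ p ∧ ∀ i, |p i - v i| ≤ δ / 2 := by
  refine ⟨WithLp.toLp 2 fun i => x i + δ * round ((v i - x i) / δ),
    (latticeClass_eq_iff hδ).2 ⟨fun i => round ((v i - x i) / δ), fun i => rfl⟩, fun i => ?_⟩
  have h := abs_sub_round ((v i - x i) / δ)
  have h1 : x i + δ * round ((v i - x i) / δ) - v i =
      -(δ * ((v i - x i) / δ - round ((v i - x i) / δ))) := by
    rw [mul_sub, mul_div_cancel₀ _ hδ.ne']; ring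
  change |x i + δ * round ((v i - x i) / δ) - v i| ≤ δ / 2
  rw [h1, abs_neg, abs_mul, abs_of_pos hδ]
  nlinarith

/-- Each point of a set of points congruent modulo `δ ℤ^d` owns a cube of side `δ / 2`, in the
orthant at the point that contains the gradient, where `f` stays above its value at the point. -/
theorem card_mul_pow_le_volume_shell {δ : ℝ} (hδ : 0 < δ)
    {D : Set (EuclideanSpace ℝ (Fin d))} (hD : IsCompact D) {f : EuclideanSpace ℝ (Fin d) → ℝ}
    (hf : ConvexOn ℝ D f) {K : ℝ≥0} (hK : LipschitzOnWith K f D) {η c₁ c₂ : ℝ}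
    (hη : K * (Real.sqrt d * (δ / 2)) ≤ η)
    (A : Finset (EuclideanSpace ℝ (Fin d)))
    (hAc : ∀ p ∈ A, ∀ q ∈ A, latticeClass δ p = latticeClass δ q)
    (hAD : ∀ p ∈ A, p ∈ D ∧ c₁ < f p ∧ f p ≤ c₂)
    (hAd : ∀ p ∈ A, DifferentiableAt ℝ f p)
    (hmargin : ∀ p ∈ A, ∀ u : EuclideanSpace ℝ (Fin d), (∀ i, |u i - p i| ≤ δ / 2) → u ∈ D) :
    (A.card : ℝ) * (δ / 2) ^ d ≤ volume.real {x | x ∈ D ∧ c₁ < f x ∧ f x ≤ c₂ + η} := by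
  classical
  let lo : EuclideanSpace ℝ (Fin d) → Fin d → ℝ := fun p i =>
    if 0 ≤ (∇ f p) i then p i else p i - δ / 2
  let hi : EuclideanSpace ℝ (Fin d) → Fin d → ℝ := fun p i =>
    if 0 ≤ (∇ f p) i then p i + δ / 2 else p i
  let Q : EuclideanSpace ℝ (Fin d) → Set (EuclideanSpace ℝ (Fin d)) := fun p =>
    {u | ∀ i, u i ∈ Ioo (lo p i) (hi p i)}
  have hdiff : ∀ p i, hi p i - lo p i = δ / 2 := fun p i => by
    by_cases h : 0 ≤ (∇ f p) i <;> simp [lo, hi, h]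
  have habs : ∀ p, ∀ u ∈ Q p, ∀ i, |u i - p i| < δ / 2 := by
    intro p u hu i
    have h1 := hu i
    by_cases h : 0 ≤ (∇ f p) i
    · simp only [lo, hi, h, if_true, mem_Ioo] at h1
      rw [abs_lt]; constructor <;> linarith
    · simp only [lo, hi, h, if_false, mem_Ioo] at h1
      rw [abs_lt]; constructor <;> linarith
  have hpos : ∀ p, ∀ u ∈ Q p, 0 ≤ ⟪∇ f p, u - p⟫ := by
    intro p u hu
    rw [PiLp.inner_apply]
    refine Finset.sum_nonneg fun i _ => ?_
    have h1 := hu i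
    simp only [PiLp.sub_apply, RCLike.inner_apply, conj_trivial]
    by_cases h : 0 ≤ (∇ f p) i
    · simp only [lo, hi, h, if_true, mem_Ioo] at h1
      exact mul_nonneg (by linarith) h
    · simp only [lo, hi, h, if_false, mem_Ioo] at h1
      exact mul_nonneg_of_nonpos_of_nonpos (by linarith) (not_le.1 h).le
  have hQsub : ∀ p ∈ A, Q p ⊆ {x | x ∈ D ∧ c₁ < f x ∧ f x ≤ c₂ + η} := by
    intro p hp u hu
    have hle : ∀ i, |u i - p i| ≤ δ / 2 := fun i => (habs p u hu i).le
    have huD := hmargin p hp u hle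
    have h1 := hf.add_inner_gradient_le (hAD p hp).1 huD (hAd p hp)
    have h2 := hK.dist_le_mul u huD p (hAD p hp).1
    have h3 : dist u p ≤ Real.sqrt d * (δ / 2) := by
      rw [dist_eq_norm]
      exact EuclideanSpace.norm_le_sqrt_mul_of_abs_le (by positivity) hle
    have h4 := mul_le_mul_of_nonneg_left h3 K.coe_nonneg
    rw [Real.dist_eq] at h2
    have h5 := le_of_abs_le h2
    refine ⟨huD, ?_, ?_⟩
    · linarith [hpos p u hu, (hAD p hp).2.1]
    · linarith [(hAD p hp).2.2]
  have hdisj : PairwiseDisjoint (↑A) Q := by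
    intro p hp q hq hpq
    rw [Function.onFun, Set.disjoint_left]
    intro u hup huq
    refine hpq ?_
    obtain ⟨z, hz⟩ := (latticeClass_eq_iff hδ).1 (hAc p hp q hq)
    ext i
    have h1 := abs_lt.1 (habs p u hup i)
    have h2 := abs_lt.1 (habs q u huq i)
    have h3 := hz i
    have h4 : (z i : ℝ) < 1 := by nlinarith
    have h5 : (-1 : ℝ) < z i := by nlinarith
    have h6 : z i = 0 := by
      have : z i < 1 := by exact_mod_cast h4
      have : -1 < z i := by exact_mod_cast h5
      omega
    rw [h3, h6]; simp
  have hlohi : ∀ p, lo p ≤ hi p := fun p i => by linarith [hdiff p i]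
  have hfin : volume {x | x ∈ D ∧ c₁ < f x ∧ f x ≤ c₂ + η} ≠ ⊤ :=
    ((measure_mono fun x hx => hx.1).trans_lt hD.measure_lt_top).ne
  calc (A.card : ℝ) * (δ / 2) ^ d = ∑ p ∈ A, volume.real (Q p) := by
        have : ∀ p ∈ A, volume.real (Q p) = (δ / 2) ^ d := fun p _ => by
          rw [EuclideanSpace.volume_real_box (hlohi p)]
          simp only [hdiff, Finset.prod_const, Finset.card_univ, Fintype.card_fin]
        rw [Finset.sum_congr rfl this, Finset.sum_const, nsmul_eq_mul]
    _ = volume.real (⋃ p ∈ A, Q p) := by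
        rw [measureReal_biUnion_finset hdisj (fun p _ => EuclideanSpace.measurableSet_box _ _)
          fun p hp => ((measure_mono (hQsub p hp)).trans_lt hfin.lt_top).ne]
    _ ≤ _ := measureReal_mono (iUnion₂_subset hQsub) hfin

/-- The cubes of side `δ` about the points of `B` cover `S`. -/
theorem volume_real_le_card_mul_pow {δ : ℝ} (hδ : 0 < δ) {S : Set (EuclideanSpace ℝ (Fin d))}
    (B : Finset (EuclideanSpace ℝ (Fin d)))
    (hB : ∀ v ∈ S, ∃ p ∈ B, ∀ i, |p i - v i| ≤ δ / 2) :
    volume.real S ≤ (B.card : ℝ) * δ ^ d := by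
  let Q : EuclideanSpace ℝ (Fin d) → Set (EuclideanSpace ℝ (Fin d)) := fun p =>
    {u | ∀ i, u i ∈ Icc (p i - δ / 2) (p i + δ / 2)}
  have hle : ∀ p : EuclideanSpace ℝ (Fin d),
      (fun i => p i - δ / 2) ≤ fun i => p i + δ / 2 := fun p i => by
    change p i - δ / 2 ≤ p i + δ / 2
    linarith
  have hvol : ∀ p, volume.real (Q p) = δ ^ d := fun p => by
    rw [EuclideanSpace.volume_real_closed_box (hle p)]
    simp
  have hfin : ∀ p, volume (Q p) ≠ ⊤ := fun p h => by
    have h1 := hvol p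
    rw [Measure.real, h, ENNReal.toReal_top] at h1
    exact (pow_pos hδ d).ne h1
  calc volume.real S ≤ volume.real (⋃ p ∈ B, Q p) := by
        refine measureReal_mono (fun v hv => ?_) ?_
        · obtain ⟨p, hp, h⟩ := hB v hv
          refine mem_iUnion₂.2 ⟨p, hp, fun i => ?_⟩
          have := abs_le.1 (h i)
          constructor <;> linarith
        · exact (measure_biUnion_finset_le B Q).trans_lt
            (ENNReal.sum_lt_top.2 fun p _ => (hfin p).lt_top) |>.ne
    _ ≤ ∑ p ∈ B, volume.real (Q p) := measureReal_biUnion_finset_le B Q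
    _ = (B.card : ℝ) * δ ^ d := by
        rw [Finset.sum_congr rfl fun p _ => hvol p, Finset.sum_const, nsmul_eq_mul]

open scoped Classical in
/-- The numbers of grid points in two shells of a convex function, compared through the volumes of
the shells. Here `η` bounds the difference between the values of `f` at the center and at the other
points of a cube of side `δ`. The gradient bound need not hold where `f ≤ c₁`, which is why the
points of the inner shell own cubes in one orthant only and not the full cubes about them. -/
theorem ConvexOn.card_shell_mul_le {δ : ℝ} (hδ : 0 < δ) (hd : 1 ≤ d)
    {D : Set (EuclideanSpace ℝ (Fin d))} (hD : IsCompact D)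
    {P : Finset (EuclideanSpace ℝ (Fin d))} (hP : IsUniformGrid δ D P)
    {f : EuclideanSpace ℝ (Fin d) → ℝ}
    (hf : ConvexOn ℝ D f) {K : ℝ≥0} (hK : LipschitzOnWith K f D) {k η c₁ c₂ c₃ c₄ : ℝ}
    (hk : 0 < k) (hη : K * (Real.sqrt d * (δ / 2)) ≤ η)
    (h12 : c₁ < c₂) (h23 : c₂ + η < c₃) (h34 : c₃ + 2 * η < c₄)
    (hint : ∀ x ∈ D, f x < c₄ → x ∈ interior D)
    (hgrad : ∀ x ∈ D, c₁ < f x → f x < c₄ → DifferentiableAt ℝ f x ∧ k ≤ ‖∇ f x‖) :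
    ((P.filter fun x => c₁ < f x ∧ f x ≤ c₂).card : ℝ) * ((c₃ - c₂ - η) * k) ≤
      2 ^ d * ((c₂ + η - c₁) * K) * ((P.filter fun x => c₂ < f x ∧ f x ≤ c₃ + η).card : ℝ) := by
  have : Nonempty (Fin d) := ⟨⟨0, hd⟩⟩
  have hη0 : 0 ≤ η := le_trans (by positivity) hη
  set A := P.filter fun x => c₁ < f x ∧ f x ≤ c₂ with hA
  set B := P.filter fun x => c₂ < f x ∧ f x ≤ c₃ + η with hB
  have hclose : ∀ s u : EuclideanSpace ℝ (Fin d), (∀ i, |u i - s i| ≤ δ / 2) →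
      K * dist u s ≤ η := fun s u h => by
    refine (mul_le_mul_of_nonneg_left ?_ K.coe_nonneg).trans hη
    rw [dist_eq_norm]
    exact EuclideanSpace.norm_le_sqrt_mul_of_abs_le (by positivity) h
  have hfclose : ∀ s ∈ D, ∀ u ∈ D, (∀ i, |u i - s i| ≤ δ / 2) → |f u - f s| ≤ η :=
    fun s hs u hu h => by
      rw [← Real.dist_eq]
      exact (hK.dist_le_mul u hu s hs).trans (hclose s u h)
  let S : Set (EuclideanSpace ℝ (Fin d)) := {x | x ∈ D ∧ f x ≤ c₃ + η}
  have hS : Convex ℝ S := hf.convex_le (c₃ + η)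
  have hSD : ∀ s ∈ S, ∀ u : EuclideanSpace ℝ (Fin d), (∀ i, |u i - s i| ≤ δ / 2) → u ∈ D :=
    fun s hs u hu => hK.mem_of_add_mul_dist_lt hD.isClosed hint hs.1
      (by linarith [hclose s u hu, hs.2])
  have hvol := hf.measureReal_shell_le hD hK hk (c₁ := c₁) (c₂ := c₂ + η) (c₃ := c₃)
    (by linarith) h23 (by linarith) hint hgrad
  set vin := volume.real {x | x ∈ D ∧ c₁ < f x ∧ f x ≤ c₂ + η}
  set vout := volume.real {x | x ∈ D ∧ c₂ + η < f x ∧ f x ≤ c₃}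
  -- the comparison within one class modulo `δ ℤ^d`
  have hclass : ∀ r ∈ A.image (latticeClass δ),
      ((A.filter fun x => latticeClass δ x = r).card : ℝ) * ((c₃ - c₂ - η) * k) ≤
        2 ^ d * ((c₂ + η - c₁) * K) * ((B.filter fun x => latticeClass δ x = r).card : ℝ) := by
    intro r hr
    obtain ⟨x₀, hx₀, rfl⟩ := Finset.mem_image.1 hr
    have hx₀' := Finset.mem_filter.1 hx₀
    have hx₀S : x₀ ∈ S := ⟨hP.subset x₀ hx₀'.1, by linarith [hx₀'.2.2]⟩
    have hin := card_mul_pow_le_volume_shell hδ hD hf hK hη (c₁ := c₁) (c₂ := c₂)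
      (A.filter fun x => latticeClass δ x = latticeClass δ x₀)
      (fun p hp q hq => (Finset.mem_filter.1 hp).2.trans (Finset.mem_filter.1 hq).2.symm)
      (fun p hp => by
        have h := Finset.mem_filter.1 (Finset.mem_filter.1 hp).1
        exact ⟨hP.subset p h.1, h.2⟩)
      (fun p hp => by
        have h := Finset.mem_filter.1 (Finset.mem_filter.1 hp).1
        exact (hgrad p (hP.subset p h.1) h.2.1 (by linarith [h.2.2])).1)
      (fun p hp => by
        have h := Finset.mem_filter.1 (Finset.mem_filter.1 hp).1
        exact hSD p ⟨hP.subset p h.1, by linarith [h.2.2]⟩)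
    have hout : vout ≤ ((B.filter fun x => latticeClass δ x = latticeClass δ x₀).card : ℝ) *
        δ ^ d := by
      refine volume_real_le_card_mul_pow hδ _ fun v hv => ?_
      obtain ⟨p, hpc, hpv⟩ := exists_latticeClass_eq_abs_sub_le hδ x₀ v
      have hvS : v ∈ S := ⟨hv.1, by linarith [hv.2.2]⟩
      have hpD := hSD v hvS p hpv
      have h1 := abs_le.1 (hfclose v hv.1 p hpD hpv)
      have hpS : p ∈ S := ⟨hpD, by linarith [hv.2.2]⟩
      obtain ⟨z, hz⟩ := (latticeClass_eq_iff hδ).1 hpc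
      have hpP : p ∈ P := hP.mem_of_forall_add_mul hδ hS hSD hpS _ x₀ x₀ z rfl hx₀'.1 hx₀S
        (fun i => by rw [sub_self, abs_zero]; positivity) hz
      refine ⟨p, Finset.mem_filter.2 ⟨Finset.mem_filter.2 ⟨hpP, ?_, hpS.2⟩, hpc.symm⟩, hpv⟩
      linarith [hv.2.1]
    set nA : ℝ := ((A.filter fun x => latticeClass δ x = latticeClass δ x₀).card : ℝ)
    set nB : ℝ := ((B.filter fun x => latticeClass δ x = latticeClass δ x₀).card : ℝ)
    have hδd : 0 < (δ / 2) ^ d := by positivity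
    have hδ2 : δ ^ d = 2 ^ d * (δ / 2) ^ d := by
      rw [← mul_pow]; congr 1; ring
    have hc1 : 0 ≤ (c₃ - c₂ - η) * k := mul_nonneg (by linarith) hk.le
    have hc2 : 0 ≤ (c₂ + η - c₁) * K := mul_nonneg (by linarith) K.coe_nonneg
    refine le_of_mul_le_mul_right ?_ hδd
    calc nA * ((c₃ - c₂ - η) * k) * (δ / 2) ^ d = (c₃ - c₂ - η) * k * (nA * (δ / 2) ^ d) := by ring
      _ ≤ (c₃ - c₂ - η) * k * vin := mul_le_mul_of_nonneg_left hin hc1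
      _ = (c₃ - (c₂ + η)) * k * vin := by ring
      _ ≤ (c₂ + η - c₁) * K * vout := hvol
      _ ≤ (c₂ + η - c₁) * K * (nB * δ ^ d) := mul_le_mul_of_nonneg_left hout hc2
      _ = 2 ^ d * ((c₂ + η - c₁) * K) * nB * (δ / 2) ^ d := by rw [hδ2]; ring
  have hAsum : (A.card : ℝ) = ∑ r ∈ A.image (latticeClass δ),
      ((A.filter fun x => latticeClass δ x = r).card : ℝ) := by
    rw [Finset.card_eq_sum_card_image (latticeClass δ) A]
    push_cast
    rfl
  have hBsum : ∑ r ∈ A.image (latticeClass δ),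
      ((B.filter fun x => latticeClass δ x = r).card : ℝ) ≤ B.card := by
    have h := Finset.sum_card_fiberwise_eq_card_filter B (A.image (latticeClass δ))
      (latticeClass δ)
    have h2 : ∑ r ∈ A.image (latticeClass δ), (B.filter fun x => latticeClass δ x = r).card ≤
        B.card := by
      rw [h]; exact Finset.card_filter_le _ _
    exact_mod_cast h2
  rw [hAsum, Finset.sum_mul]
  refine (Finset.sum_le_sum hclass).trans ?_
  rw [← Finset.mul_sum]
  exact mul_le_mul_of_nonneg_left hBsum
    (mul_nonneg (by positivity) (mul_nonneg (by linarith) K.coe_nonneg))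

end Counting

/-! ### The estimate as a moving average -/

section Estimate

theorem estimate_of_le {X : Type*} (T : ℕ) (obs : ℕ → X → ℝ) (x : X) :
    ∀ t, 1 ≤ t → t ≤ T →
      estimate T obs t x = 1 / (t : ℝ) * ∑ i ∈ Finset.range t, obs (i + 1) x := by
  intro t ht
  induction t, ht using Nat.le_induction with
  | base =>
    intro hT
    have h1 : (1 : ℝ) ≤ T := by exact_mod_cast hT
    simp [estimate, h1, not_lt.2 hT]
  | succ t ht ih =>
    intro hT
    have h1 : (t : ℝ) + 1 ≤ T := by exact_mod_cast hT
    have h0 : (t : ℝ) ≠ 0 := by positivity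
    have h2 : (t : ℝ) + 1 ≠ 0 := by positivity
    rw [estimate, ih (by omega), min_eq_left (by linarith), min_eq_left h1, if_neg (by omega),
      Finset.sum_range_succ]
    push_cast
    field_simp
    ring

/-- From time `T` on, the estimate is the average of the last `T` observations. -/
theorem estimate_add {X : Type*} {T : ℕ} (hT : 1 ≤ T) (obs : ℕ → X → ℝ) (x : X) (m : ℕ) :
    estimate T obs (T + m) x = 1 / (T : ℝ) * ∑ i ∈ Finset.range T, obs (m + 1 + i) x := by
  have hT0 : (T : ℝ) ≠ 0 := by positivity
  induction m with
  | zero =>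
    rw [add_zero, estimate_of_le T obs x T hT le_rfl]
    simp [add_comm]
  | succ m ih =>
    have h1 : (T : ℝ) ≤ T + m := by linarith [Nat.cast_nonneg (α := ℝ) m]
    have h2 : ∑ i ∈ Finset.range T, obs (m + 1 + 1 + i) x + obs (m + 1) x =
        ∑ i ∈ Finset.range T, obs (m + 1 + i) x + obs (T + m + 1) x := by
      have h3 := Finset.sum_range_succ (fun i => obs (m + 1 + i) x) T
      have h4 := Finset.sum_range_succ' (fun i => obs (m + 1 + i) x) T
      rw [h3] at h4
      rw [show T + m + 1 = m + 1 + T by ring]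
      simp only [add_zero] at h4
      rw [h4]
      congr 1
      exact Finset.sum_congr rfl fun i _ => by congr 1; ring
    rw [← add_assoc, estimate, ih, if_pos (by omega)]
    push_cast
    rw [min_eq_right (by linarith), min_eq_right (by linarith),
      show T + m + 1 - T = m + 1 by omega, eq_sub_of_add_eq h2]
    field_simp
    ring

end Estimate

/-! ### Deviations of averages of bounded noise -/

section Noise

open MeasureTheory ProbabilityTheory

/-- The inequality of Hoeffding for the mean of `T` independent variables. The interval may be
longer than the actual range. -/
theorem measureReal_le_sum_le_exp_of_mem_Icc {Ω : Type*} [MeasurableSpace Ω] {μ : Measure Ω}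
    [IsProbabilityMeasure μ] {X : ℕ → Ω → ℝ} (hX : ∀ i, Measurable (X i)) (hind : iIndepFun X μ)
    (hmean : ∀ i, ∫ ω, X i ω ∂μ = 0) {A L : ℝ} (hL : 0 < L)
    (hb : ∀ i, ∀ᵐ ω ∂μ, X i ω ∈ Set.Icc A (A + L)) {T : ℕ} (hT : 1 ≤ T) {u : ℝ} (hu : 0 ≤ u) :
    μ.real {ω | T * u ≤ ∑ i ∈ Finset.range T, X i ω} ≤ Real.exp (-(2 * T * u ^ 2 / L ^ 2)) := by
  have hT0 : (0 : ℝ) < T := by exact_mod_cast hT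
  refine (HasSubgaussianMGF.measure_sum_range_ge_le_of_iIndepFun hind
    (fun i _ => hasSubgaussianMGF_of_mem_Icc_of_integral_eq_zero (hX i).aemeasurable (hb i)
      (hmean i)) (mul_nonneg hT0.le hu)).trans_eq ?_
  congr 1
  push_cast
  rw [add_sub_cancel_left, Real.norm_of_nonneg hL.le]
  field_simp

end Noise

/-! ### Drift over a window -/

section Drift

theorem abs_sub_le_mul_of_abs_succ_sub_le {g : ℕ → ℝ} {Δ : ℝ}
    (h : ∀ t, 1 ≤ t → |g (t + 1) - g t| ≤ Δ) {s : ℕ} (hs : 1 ≤ s) (j : ℕ) :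
    |g s - g (s + j)| ≤ j * Δ := by
  induction j with
  | zero => simp
  | succ j ih =>
    have h1 := h (s + j) (by omega)
    rw [abs_sub_comm] at h1
    have h2 := abs_sub_le (g s) (g (s + j)) (g (s + j + 1))
    rw [← add_assoc]
    push_cast
    linarith

/-- The sum of a slowly varying sequence over a window of length `T`, compared with `T` times its
value at the end of the window: the deviations are at most `0, Δ, …, (T - 1) Δ`. -/
theorem abs_sum_window_sub_le {g : ℕ → ℝ} {Δ : ℝ} (h : ∀ t, 1 ≤ t → |g (t + 1) - g t| ≤ Δ)
    (T m : ℕ) :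
    |∑ i ∈ Finset.range T, g (m + 1 + i) - T * g (T + m)| ≤ T * ((T - 1) * Δ / 2) := by
  have h1 : ∑ i ∈ Finset.range T, g (m + 1 + i) - T * g (T + m) =
      ∑ i ∈ Finset.range T, (g (m + 1 + i) - g (T + m)) := by
    simp [Finset.sum_sub_distrib]
  have h2 : ∀ i ∈ Finset.range T, |g (m + 1 + i) - g (T + m)| ≤ ((T - 1 - i : ℕ) : ℝ) * Δ := by
    intro i hi
    have hi := Finset.mem_range.1 hi
    have h3 := abs_sub_le_mul_of_abs_succ_sub_le h (s := m + 1 + i) (by omega) (T - 1 - i)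
    rwa [show m + 1 + i + (T - 1 - i) = T + m by omega] at h3
  rw [h1]
  refine (Finset.abs_sum_le_sum_abs _ _).trans ((Finset.sum_le_sum h2).trans_eq ?_)
  rw [Finset.sum_range_reflect (fun i => (i : ℝ) * Δ) T, ← Finset.sum_mul, ← Nat.cast_sum]
  have h4 := Finset.sum_range_id_mul_two T
  have h5 : ((∑ i ∈ Finset.range T, i : ℕ) : ℝ) * 2 = T * (T - 1) := by
    rcases T with _ | T
    · simp
    · rw [Nat.add_sub_cancel] at h4
      have h6 := congrArg (Nat.cast : ℕ → ℝ) h4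
      rw [Nat.cast_mul, Nat.cast_mul, Nat.cast_ofNat] at h6
      rw [h6, Nat.cast_succ, add_sub_cancel_right]
  linear_combination Δ / 2 * h5

end Drift

/-! ### Weighted sums over slices -/

section UnionBound

/-- Moving weight to the front of a decreasing sequence does not decrease the sum. The last weight
`w lm` is determined by the total and may be negative. The unit of weight in front of the sum of
the `c l` pays for the event that the noise at the reference point is large. -/
theorem add_sum_mul_le_sum_mul_of_antitone {lm : ℕ} {e c w : ℕ → ℝ} {n : ℝ} (he : Antitone e)
    (he0 : ∀ l, 0 ≤ e l) (hc0 : 0 < lm → 1 + c 0 ≤ w 0) (hc : ∀ l < lm, c l ≤ w l)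
    (hcn : 1 + ∑ l ∈ Finset.range (lm + 1), c l ≤ n)
    (hw : ∑ l ∈ Finset.range (lm + 1), w l = n) :
    e 0 + ∑ l ∈ Finset.range (lm + 1), c l * e l ≤ ∑ l ∈ Finset.range (lm + 1), w l * e l := by
  let c' : ℕ → ℝ := fun l => c l + if l = 0 then 1 else 0
  have hc' : ∑ l ∈ Finset.range (lm + 1), c' l = 1 + ∑ l ∈ Finset.range (lm + 1), c l := by
    simp [c', Finset.sum_add_distrib, add_comm]
  have hc'e : ∑ l ∈ Finset.range (lm + 1), c' l * e l =
      e 0 + ∑ l ∈ Finset.range (lm + 1), c l * e l := by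
    simp [c', add_mul, Finset.sum_add_distrib, add_comm]
  have h1 : ∀ l ∈ Finset.range (lm + 1), (w l - c' l) * e lm ≤ (w l - c' l) * e l := by
    intro l hl
    rcases (Nat.lt_succ_iff.1 (Finset.mem_range.1 hl)).eq_or_lt with rfl | hlt
    · exact le_rfl
    · refine mul_le_mul_of_nonneg_left (he hlt.le) ?_
      by_cases h0 : l = 0
      · subst h0
        simp only [c', if_true]
        linarith [hc0 hlt]
      · simp only [c', h0, if_false, add_zero]
        linarith [hc l hlt]
  have h2 := Finset.sum_le_sum h1
  rw [← Finset.sum_mul, Finset.sum_sub_distrib, hc', hw] at h2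
  simp only [sub_mul, Finset.sum_sub_distrib] at h2
  rw [hc'e] at h2
  nlinarith [he0 lm, mul_nonneg (sub_nonneg.2 hcn) (he0 lm)]

open scoped Classical in
/-- The points of `P` split by the height `g`: slices of height `ε` above the level `ε`, with
everything above the level `(lm + 1) ε` in the last one. -/
noncomputable def heightSlice {X : Type*} (P : Finset X) (g : X → ℝ) (ε : ℝ) (lm l : ℕ) :
    Finset X :=
  P.filter fun x => ((l : ℝ) + 1) * ε < g x ∧ (l < lm → g x ≤ ((l : ℝ) + 2) * ε)

variable {X : Type*} {P : Finset X} {g : X → ℝ} {ε : ℝ} {lm : ℕ}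

theorem exists_mem_heightSlice {x : X} (hx : x ∈ P) (hgx : ε < g x) :
    ∃ l ∈ Finset.range (lm + 1), x ∈ heightSlice P g ε lm l := by
  by_contra! h
  have hall : ∀ j : ℕ, j ≤ lm → ((j : ℝ) + 1) * ε < g x := by
    intro j
    induction j with
    | zero => intro _; simpa using hgx
    | succ j ih =>
      intro hj
      by_contra! hle
      refine h j (Finset.mem_range.2 (by omega)) (Finset.mem_filter.2 ⟨hx, ih (by omega), ?_⟩)
      intro _
      push_cast at hle
      linarith
  exact h lm (Finset.mem_range.2 (by omega)) (Finset.mem_filter.2 ⟨hx, hall lm le_rfl,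
    fun h => absurd h (lt_irrefl _)⟩)

theorem one_add_sum_card_heightSlice_le (hε : 0 < ε) {y : X} (hy : y ∈ P) (hgy : g y ≤ ε) :
    1 + ∑ l ∈ Finset.range (lm + 1), (heightSlice P g ε lm l).card ≤ P.card := by
  classical
  have hdisj : ((Finset.range (lm + 1) : Finset ℕ) : Set ℕ).PairwiseDisjoint
      (heightSlice P g ε lm) := by
    have hlt : ∀ i j : ℕ, i < j → j ≤ lm →
        Disjoint (heightSlice P g ε lm i) (heightSlice P g ε lm j) := by
      intro i j hij hj
      rw [Finset.disjoint_left]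
      intro x hxi hxj
      have h1 := (Finset.mem_filter.1 hxi).2.2 (by omega)
      have h2 := (Finset.mem_filter.1 hxj).2.1
      have h3 : (i : ℝ) + 1 ≤ j := by exact_mod_cast hij
      nlinarith
    intro i hi j hj hij
    have hi' := Finset.mem_range.1 (Finset.mem_coe.1 hi)
    have hj' := Finset.mem_range.1 (Finset.mem_coe.1 hj)
    rcases lt_or_gt_of_ne hij with h | h
    · exact hlt i j h (by omega)
    · exact (hlt j i h (by omega)).symm
  rw [← Finset.card_biUnion hdisj]
  have hsub : (Finset.range (lm + 1)).biUnion (heightSlice P g ε lm) ⊆ P.erase y := by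
    intro x hx
    obtain ⟨l, -, hxl⟩ := Finset.mem_biUnion.1 hx
    have h1 := Finset.mem_filter.1 hxl
    refine Finset.mem_erase.2 ⟨?_, h1.1⟩
    rintro rfl
    have h2 := h1.2.1
    have h3 : (0 : ℝ) ≤ l := Nat.cast_nonneg l
    nlinarith
  have h1 := Finset.card_le_card hsub
  rw [Finset.card_erase_of_mem hy] at h1
  have h2 : 0 < P.card := Finset.card_pos.2 ⟨y, hy⟩
  omega

end UnionBound

/-! ### The failure probability of a minimizer -/

section Hitting

open MeasureTheory ProbabilityTheory

/-- The union bound for the failure probability of the minimizer of a noisy average. The averages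
over the window differ by at most `ε / 7` from the present heights, so that a point of height more
than `(l + 1) ε` can beat the reference point `y` only if the average noise at `y` is at least
`2 ε / 7` or the average noise at that point is at most `-(l + 2 / 7) ε`. -/
theorem one_sub_le_measureReal_forall_minimizer {Ω X : Type*} [MeasurableSpace Ω] {μ : Measure Ω}
    [IsProbabilityMeasure μ] {P : Finset X} {est : X → Ω → ℝ} {g avg : X → ℝ} {S : X → Ω → ℝ}
    {T : ℕ} (hT : 1 ≤ T) {ε a L : ℝ} (hε : 0 < ε)
    (hest : ∀ x ∈ P, ∀ ω, T * est x ω = avg x + S x ω) {m : ℝ}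
    (havg : ∀ x ∈ P, |avg x - T * (m + g x)| ≤ T * (ε / 7)) (hg0 : ∀ x ∈ P, 0 ≤ g x)
    {y : X} (hy : y ∈ P) (hgy : g y ≤ ε / 7)
    (hS : ∀ x ∈ P, ∀ u : ℝ, 0 ≤ u →
      μ.real {ω | T * u ≤ S x ω} ≤ Real.exp (-(2 * T * u ^ 2 / L ^ 2)) ∧
      μ.real {ω | T * u ≤ -S x ω} ≤ Real.exp (-(2 * T * u ^ 2 / L ^ 2)))
    {lm : ℕ} {nl : ℕ → ℝ}
    (hn0 : 0 < lm → 1 + ((heightSlice P g ε lm 0).card : ℝ) ≤ nl 0)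
    (hnl : ∀ l < lm, ((heightSlice P g ε lm l).card : ℝ) ≤ nl l)
    (hsum : ∑ l ∈ Finset.range (lm + 1), nl l = (P.card : ℝ))
    (ha : ∑ l ∈ Finset.range (lm + 1),
      nl l * Real.exp (-(2 * (T : ℝ) * ((l : ℝ) + 2 / 7) ^ 2 * ε ^ 2 / L ^ 2)) ≤ a) :
    1 - a ≤ μ.real {ω | ∀ x ∈ P, (∀ z ∈ P, est x ω ≤ est z ω) → |g x| ≤ ε} := by
  have hT0 : (0 : ℝ) < T := by exact_mod_cast hT
  let e : ℕ → ℝ := fun l => Real.exp (-(2 * (T : ℝ) * ((l : ℝ) + 2 / 7) ^ 2 * ε ^ 2 / L ^ 2))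
  let bad : X → ℕ → Set Ω := fun x l => {ω | T * (((l : ℝ) + 2 / 7) * ε) ≤ -S x ω}
  let bady : Set Ω := {ω | T * (2 / 7 * ε) ≤ S y ω}
  let B : Set Ω := bady ∪ ⋃ l ∈ Finset.range (lm + 1), ⋃ x ∈ heightSlice P g ε lm l, bad x l
  have hcover : Set.univ ⊆
      {ω | ∀ x ∈ P, (∀ z ∈ P, est x ω ≤ est z ω) → |g x| ≤ ε} ∪ B := by
    intro ω _
    by_contra hω
    rw [Set.mem_union, not_or] at hω
    obtain ⟨h1, h2⟩ := hω
    simp only [Set.mem_ofPred_eq] at h1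
    push Not at h1
    obtain ⟨x, hx, hxmin, hgx⟩ := h1
    rw [abs_of_nonneg (hg0 x hx)] at hgx
    obtain ⟨l, hl, hxl⟩ := exists_mem_heightSlice (lm := lm) hx hgx
    have h3 := (Finset.mem_filter.1 hxl).2.1
    have hy' : S y ω < T * (2 / 7 * ε) := not_le.1 fun h => h2 (Or.inl h)
    have hx' : -S x ω < T * (((l : ℝ) + 2 / 7) * ε) := not_le.1 fun h =>
      h2 (Or.inr (Set.mem_iUnion₂.2 ⟨l, hl, Set.mem_iUnion₂.2 ⟨x, hxl, h⟩⟩))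
    have h4 := mul_le_mul_of_nonneg_left (hxmin y hy) hT0.le
    rw [hest x hx, hest y hy] at h4
    have h5 := (abs_le.1 (havg x hx)).1
    have h6 := (abs_le.1 (havg y hy)).2
    have h7 := mul_lt_mul_of_pos_left h3 hT0
    have h8 := mul_le_mul_of_nonneg_left hgy hT0.le
    linarith
  have hbady : μ.real bady ≤ e 0 := by
    refine ((hS y hy _ (by positivity)).1).trans_eq ?_
    simp only [e]
    congr 1
    push_cast
    ring
  have hbad : ∀ l, ∀ x ∈ heightSlice P g ε lm l, μ.real (bad x l) ≤ e l := by
    intro l x hx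
    refine ((hS x (Finset.mem_filter.1 hx).1 _ (by positivity)).2).trans_eq ?_
    simp only [e]
    congr 1
    ring
  have hB : μ.real B ≤ e 0 + ∑ l ∈ Finset.range (lm + 1),
      ((heightSlice P g ε lm l).card : ℝ) * e l := by
    refine (measureReal_union_le _ _).trans (add_le_add hbady ?_)
    refine (measureReal_biUnion_finset_le _ _).trans (Finset.sum_le_sum fun l _ => ?_)
    refine (measureReal_biUnion_finset_le _ _).trans ((Finset.sum_le_sum (hbad l)).trans_eq ?_)
    rw [Finset.sum_const, nsmul_eq_mul]
  have hanti : Antitone e := by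
    intro i j hij
    have h1 : (i : ℝ) ≤ j := by exact_mod_cast hij
    simp only [e]
    gcongr
  have hfin := add_sum_mul_le_sum_mul_of_antitone (lm := lm) (w := nl) (n := (P.card : ℝ))
    (c := fun l => ((heightSlice P g ε lm l).card : ℝ)) hanti (fun l => (Real.exp_pos _).le)
    hn0 hnl (by exact_mod_cast one_add_sum_card_heightSlice_le hε hy (by linarith)) hsum
  have h1 : (1 : ℝ) = μ.real Set.univ := by simp
  have h2 := (measureReal_mono (μ := μ) hcover).trans (measureReal_union_le _ _)
  linarith

end Hitting

/-! ### The length of the window -/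

section Window

open Filter Topology

theorem exists_isLeast_window {lm : ℕ} {nl : ℕ → ℝ} {ε L a : ℝ} (hε : 0 < ε) (hL : 0 < L)
    (ha : 0 < a) :
    ∃ Tmin, IsLeast {T : ℕ | 1 ≤ T ∧ ∑ l ∈ Finset.range (lm + 1),
      nl l * Real.exp (-(2 * (T : ℝ) * ((l : ℝ) + 2 / 7) ^ 2 * ε ^ 2 / L ^ 2)) ≤ a} Tmin := by
  have hterm : ∀ l : ℕ, Tendsto (fun T : ℕ =>
      nl l * Real.exp (-(2 * (T : ℝ) * ((l : ℝ) + 2 / 7) ^ 2 * ε ^ 2 / L ^ 2))) atTop (𝓝 0) := by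
    intro l
    have hpos : 0 < 2 * ((l : ℝ) + 2 / 7) ^ 2 * ε ^ 2 / L ^ 2 := by positivity
    have h1 : Tendsto (fun T : ℕ => (T : ℝ) * (2 * ((l : ℝ) + 2 / 7) ^ 2 * ε ^ 2 / L ^ 2))
        atTop atTop := tendsto_natCast_atTop_atTop.atTop_mul_const hpos
    have h2 := (Real.tendsto_exp_neg_atTop_nhds_zero.comp h1).const_mul (nl l)
    rw [mul_zero] at h2
    refine h2.congr fun T => ?_
    simp only [Function.comp]
    congr 3
    ring
  have hsum : Tendsto (fun T : ℕ => ∑ l ∈ Finset.range (lm + 1),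
      nl l * Real.exp (-(2 * (T : ℝ) * ((l : ℝ) + 2 / 7) ^ 2 * ε ^ 2 / L ^ 2))) atTop (𝓝 0) := by
    simpa using tendsto_finsetSum (Finset.range (lm + 1)) fun l _ => hterm l
  obtain ⟨T, hT, hT1⟩ := ((hsum.eventually_le_const ha).and (eventually_ge_atTop 1)).exists
  have hne : {T : ℕ | 1 ≤ T ∧ ∑ l ∈ Finset.range (lm + 1),
      nl l * Real.exp (-(2 * (T : ℝ) * ((l : ℝ) + 2 / 7) ^ 2 * ε ^ 2 / L ^ 2)) ≤ a}.Nonempty :=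
    ⟨T, hT1, hT⟩
  exact ⟨sInf _, Nat.sInf_mem hne, fun T hT => Nat.sInf_le hT⟩

theorem sum_range_pow_succ_le {r : ℝ} (hr0 : 0 ≤ r) (hr : r ≤ 1 / 4) (n : ℕ) :
    ∑ l ∈ Finset.range n, r ^ (l + 1) ≤ 4 / 3 * r := by
  have h1 := mul_neg_geom_sum r n
  have h2 : 0 ≤ r ^ n := pow_nonneg hr0 n
  have h3 : 0 ≤ ∑ l ∈ Finset.range n, r ^ l := Finset.sum_nonneg fun l _ => pow_nonneg hr0 l
  have h4 : ∑ l ∈ Finset.range n, r ^ l ≤ 4 / 3 := by nlinarith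
  simp only [pow_succ]
  rw [← Finset.sum_mul]
  exact mul_le_mul_of_nonneg_right h4 hr0

/-- If the drift over a window of length `T` can exceed `2 ε / 7`, then
`T ε² / L² > (86 / 7) ln (n / a)`. Since `(l + 2 / 7)² ≥ (4 / 49) (l + 1)` and
`2 * (4 / 49) * (86 / 7) > 2`, the `l`-th exponential is at most `(a / n) ^ (2 (l + 1))`. -/
theorem sum_mul_exp_le_of_lt_drift {lm : ℕ} {nl : ℕ → ℝ} {n ε L a T : ℝ} (hε : 0 < ε) (hL : 0 < L)
    (ha0 : 0 < a) (ha1 : a ≤ 1) (hn : 2 ≤ n) (hnl : ∀ l ≤ lm, nl l ≤ n + 1)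
    (hT : 2 * ε / 7 < T * (ε ^ 3 / (43 * L ^ 2 * Real.log (n / a)))) :
    ∑ l ∈ Finset.range (lm + 1),
      nl l * Real.exp (-(2 * T * ((l : ℝ) + 2 / 7) ^ 2 * ε ^ 2 / L ^ 2)) ≤ a := by
  have hna : 1 < n / a := by rw [lt_div_iff₀ ha0]; linarith
  have hlog : 0 < Real.log (n / a) := Real.log_pos hna
  set q := a / n with hq
  have hq0 : 0 < q := by positivity
  have hqexp : q = Real.exp (-Real.log (n / a)) := by
    rw [Real.exp_neg, Real.exp_log (by positivity), inv_div]
  have hs : 86 / 7 * Real.log (n / a) < T * ε ^ 2 / L ^ 2 := by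
    rw [mul_div_assoc', lt_div_iff₀ (by positivity)] at hT
    rw [lt_div_iff₀ (by positivity)]
    have h1 : ε * (86 / 7 * Real.log (n / a) * L ^ 2) < ε * (T * ε ^ 2) := by linarith
    exact lt_of_mul_lt_mul_left h1 hε.le
  have hterm : ∀ l : ℕ, Real.exp (-(2 * T * ((l : ℝ) + 2 / 7) ^ 2 * ε ^ 2 / L ^ 2)) ≤
      (q ^ 2) ^ (l + 1) := by
    intro l
    rw [hqexp, ← Real.exp_nat_mul, ← Real.exp_nat_mul, Real.exp_le_exp]
    have h1 : 2 * T * ((l : ℝ) + 2 / 7) ^ 2 * ε ^ 2 / L ^ 2 =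
        2 * ((l : ℝ) + 2 / 7) ^ 2 * (T * ε ^ 2 / L ^ 2) := by ring
    have hl : (0 : ℝ) ≤ l := Nat.cast_nonneg l
    have h2 : 4 / 49 * ((l : ℝ) + 1) ≤ ((l : ℝ) + 2 / 7) ^ 2 := by nlinarith
    have h3 : 2 * (4 / 49 * ((l : ℝ) + 1)) * (86 / 7 * Real.log (n / a)) ≤
        2 * ((l : ℝ) + 2 / 7) ^ 2 * (T * ε ^ 2 / L ^ 2) := by
      gcongr
    have h4 : 0 ≤ ((l : ℝ) + 1) * Real.log (n / a) := by positivity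
    rw [h1]
    push_cast
    linarith
  have hr : q ^ 2 ≤ 1 / 4 := by
    have : q ≤ 1 / 2 := by rw [hq, div_le_iff₀ (by linarith)]; linarith
    nlinarith
  calc ∑ l ∈ Finset.range (lm + 1),
        nl l * Real.exp (-(2 * T * ((l : ℝ) + 2 / 7) ^ 2 * ε ^ 2 / L ^ 2))
      ≤ ∑ l ∈ Finset.range (lm + 1), (n + 1) * (q ^ 2) ^ (l + 1) := by
        refine Finset.sum_le_sum fun l hl => ?_
        exact mul_le_mul (hnl l (Nat.lt_succ_iff.1 (Finset.mem_range.1 hl))) (hterm l)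
          (Real.exp_pos _).le (by linarith)
    _ = (n + 1) * ∑ l ∈ Finset.range (lm + 1), (q ^ 2) ^ (l + 1) := by rw [Finset.mul_sum]
    _ ≤ (n + 1) * (4 / 3 * q ^ 2) :=
        mul_le_mul_of_nonneg_left (sum_range_pow_succ_le (by positivity) hr _) (by linarith)
    _ ≤ a := by
        rw [hq, div_pow, mul_div_assoc', mul_div_assoc', div_le_iff₀ (by positivity)]
        have h1 : 4 / 3 * (n + 1) ≤ n ^ 2 := by nlinarith
        have h2 : a * (4 / 3 * (n + 1)) ≤ 1 * n ^ 2 :=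
          mul_le_mul ha1 h1 (by linarith) zero_le_one
        nlinarith

end Window

/-! ### The shells of the theorem -/

section Shells

variable {d : ℕ}

theorem div_one_add_mul_of_le {x y m n : ℝ} (hm : 0 ≤ m) (hxy : x ≤ m * y) (hn : x + y ≤ n) :
    x ≤ m / (1 + m) * n := by
  rw [div_mul_eq_mul_div, le_div_iff₀ (by linarith)]
  nlinarith

/-- The count for one shell: `ConvexOn.card_shell_mul_le` with all grid points between the height
`(l + 2) ε` and a height slightly below `M` as the outer shell. -/
theorem card_gridShell_le {δ : ℝ} (hδ : 0 < δ) (hd : 1 ≤ d)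
    {D : Set (EuclideanSpace ℝ (Fin d))} (hD : IsCompact D)
    {P : Finset (EuclideanSpace ℝ (Fin d))} (hP : IsUniformGrid δ D P)
    {f : EuclideanSpace ℝ (Fin d) → ℝ} (hf : ConvexOn ℝ D f) {K : ℝ≥0}
    (hK : LipschitzOnWith K f D) {k M ε : ℝ} (hk : 0 < k) (hε : 0 < ε)
    (hη : K * (Real.sqrt d * (δ / 2)) ≤ ε / 7)
    (hsphere : Nonempty (levelSet D f M ≃ₜ Metric.sphere (0 : EuclideanSpace ℝ (Fin d)) 1))
    (hgrad : ∀ x ∈ interior D \ lowerContour D f ε,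
      DifferentiableAt ℝ f x ∧ k ≤ ‖gradient f x‖) {l : ℕ} (hl : ((l : ℝ) + 4) * ε < M) :
    ((gridShell D P f (((l : ℝ) + 1) * ε) (((l : ℝ) + 2) * ε)).card : ℝ) ≤
      shellRatio d K k M ε l / (1 + shellRatio d K k M ε l) * (P.card : ℝ) := by
  classical
  have hlevel : levelSet D f M = {z | z ∈ D ∧ f z = M + minValue D f} := by
    ext z
    exact and_congr_right fun _ => sub_eq_iff_eq_add
  rw [hlevel] at hsphere
  have hl0 : (0 : ℝ) ≤ l := Nat.cast_nonneg l
  have hlε : 0 ≤ (l : ℝ) * ε := by positivity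
  have hint : ∀ x ∈ D, f x < M + minValue D f → x ∈ interior D := fun x hx hlt =>
    hf.mem_interior_of_homeomorph_sphere hsphere hx hlt
  have hcount := hf.card_shell_mul_le hδ hd hD hP hK hk hη
    -- `c₃` is so far below the height `M` that two steps of height `ε / 7` stay below `M`
    (c₁ := ((l : ℝ) + 1) * ε + minValue D f) (c₂ := ((l : ℝ) + 2) * ε + minValue D f)
    (c₃ := M - 3 * ε / 7 + minValue D f) (c₄ := M + minValue D f)
    (by linarith) (by linarith) (by linarith) hint fun x hx h1 h2 =>
      hgrad x ⟨hint x hx h2, fun h => by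
        have h3 : f x - minValue D f ≤ ε := h.2
        linarith⟩
  have hA : gridShell D P f (((l : ℝ) + 1) * ε) (((l : ℝ) + 2) * ε) =
      P.filter fun x => ((l : ℝ) + 1) * ε + minValue D f < f x ∧
        f x ≤ ((l : ℝ) + 2) * ε + minValue D f := by
    ext x
    simp only [gridShell, Finset.mem_filter, lt_sub_iff_add_lt, sub_le_iff_le_add]
  rw [hA]
  set A := P.filter fun x => ((l : ℝ) + 1) * ε + minValue D f < f x ∧
        f x ≤ ((l : ℝ) + 2) * ε + minValue D f
  set B := P.filter fun x => ((l : ℝ) + 2) * ε + minValue D f < f x ∧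
        f x ≤ M - 3 * ε / 7 + minValue D f + ε / 7
  have hcard : (A.card : ℝ) + B.card ≤ P.card := by
    have hdisj : Disjoint A B := by
      rw [Finset.disjoint_left]
      intro x hxA hxB
      linarith [(Finset.mem_filter.1 hxA).2.2, (Finset.mem_filter.1 hxB).2.1]
    have h := Finset.card_le_card
      (Finset.union_subset (Finset.filter_subset _ _) (Finset.filter_subset _ _) : A ∪ B ⊆ P)
    rw [Finset.card_union_of_disjoint hdisj] at h
    exact_mod_cast h
  have hden : 0 < k * (M - ((l : ℝ) + 4) * ε) := mul_pos hk (by linarith)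
  have hratio : 0 ≤ shellRatio d K k M ε l := by
    rw [shellRatio]; positivity
  refine div_one_add_mul_of_le hratio ?_ hcard
  rw [shellRatio, div_mul_eq_mul_div, le_div_iff₀ hden]
  have hA0 : (0 : ℝ) ≤ A.card := Nat.cast_nonneg _
  calc (A.card : ℝ) * (k * (M - ((l : ℝ) + 4) * ε))
      = A.card * ((M - ((l : ℝ) + 4) * ε) * k) := by ring
    _ ≤ A.card * ((M - 3 * ε / 7 + minValue D f - (((l : ℝ) + 2) * ε + minValue D f) -
          ε / 7) * k) :=
        mul_le_mul_of_nonneg_left (mul_le_mul_of_nonneg_right (by linarith) hk.le) hA0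
    _ ≤ 2 ^ d * ((((l : ℝ) + 2) * ε + minValue D f + ε / 7 -
          (((l : ℝ) + 1) * ε + minValue D f)) * K) * B.card := hcount
    _ = 2 ^ d * (8 / 7 * ε) * K * B.card := by ring
    _ ≤ 2 ^ d * (2 * ε) * K * B.card := by gcongr; norm_num
    _ = 2 ^ (d + 1) * K * ε * B.card := by ring

end Shells

/-! ### Membership in the hitting set -/

section HittingSet

open MeasureTheory ProbabilityTheory

variable {d : ℕ}

/-- A window `T` of moderate drift that satisfies the inequality with the `n_l` belongs to the
hitting set. -/
theorem mem_hittingSet {Ω : Type*} [MeasurableSpace Ω] {μ : Measure Ω} [IsProbabilityMeasure μ]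
    {D : Set (EuclideanSpace ℝ (Fin d))} {P : Finset (EuclideanSpace ℝ (Fin d))}
    {f : ℕ → EuclideanSpace ℝ (Fin d) → ℝ} {N : ℕ → EuclideanSpace ℝ (Fin d) → Ω → ℝ}
    {ε a L Δ : ℝ} (hε : 0 < ε) (hL : 0 < L) (hPD : ∀ x ∈ P, x ∈ D)
    (hmin : ∀ t, 1 ≤ t → ∀ x ∈ D, minValue D (f t) ≤ f t x)
    (hnear : ∀ t, 1 ≤ t → ∃ y ∈ P, f t y - minValue D (f t) ≤ ε / 7)
    (hNmeas : ∀ t, 1 ≤ t → ∀ x ∈ P, Measurable (N t x))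
    (hNindep : iIndepFun (fun p : {t : ℕ // 1 ≤ t} × {x // x ∈ P} => N p.1 p.2) μ)
    (hNmean : ∀ t, 1 ≤ t → ∀ x ∈ P, ∫ ω, N t x ω ∂μ = 0)
    (hNbdd : ∃ A B : ℝ, B - A < L ∧
      ∀ t, 1 ≤ t → ∀ x ∈ P, ∀ᵐ ω ∂μ, N t x ω ∈ Set.Icc A B)
    (hdrift : ∀ t, 1 ≤ t → ∀ x ∈ D, |f (t + 1) x - f t x| ≤ Δ)
    {T : ℕ} (hT : 1 ≤ T) (hTΔ : ((T : ℝ) - 1) * Δ ≤ 2 * ε / 7) {lm : ℕ} {nl : ℕ → ℝ}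
    (hnl : ∀ t, 1 ≤ t → ∀ l < lm,
      ((gridShell D P (f t) (((l : ℝ) + 1) * ε) (((l : ℝ) + 2) * ε)).card : ℝ) + 1 ≤ nl l)
    (hsum : ∑ l ∈ Finset.range (lm + 1), nl l = (P.card : ℝ))
    (ha : ∑ l ∈ Finset.range (lm + 1),
      nl l * Real.exp (-(2 * (T : ℝ) * ((l : ℝ) + 2 / 7) ^ 2 * ε ^ 2 / L ^ 2)) ≤ a) :
    T ∈ hittingSet μ D P f N ε a := by
  classical
  refine ⟨hT, fun t ht => ?_⟩
  obtain ⟨m, rfl⟩ := Nat.exists_eq_add_of_le ht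
  have ht1 : 1 ≤ T + m := by omega
  have hT0 : (0 : ℝ) < T := by exact_mod_cast hT
  obtain ⟨y, hy, hgy⟩ := hnear (T + m) ht1
  obtain ⟨A, B, hAB, hNb⟩ := hNbdd
  have hslice : ∀ l < lm, heightSlice P (fun x => f (T + m) x - minValue D (f (T + m))) ε lm l =
      gridShell D P (f (T + m)) (((l : ℝ) + 1) * ε) (((l : ℝ) + 2) * ε) := by
    intro l hl
    ext x
    simp only [heightSlice, gridShell, Finset.mem_filter, hl, true_imp_iff]
  refine one_sub_le_measureReal_forall_minimizer (L := L)
    (est := fun x ω => estimate T (fun s z => f s z + N s z ω) (T + m) x)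
    (g := fun x => f (T + m) x - minValue D (f (T + m)))
    (avg := fun x => ∑ i ∈ Finset.range T, f (m + 1 + i) x)
    (S := fun x ω => ∑ i ∈ Finset.range T, N (m + 1 + i) x ω) hT hε
    (m := minValue D (f (T + m))) (fun x _ ω => ?_) (fun x hx => ?_)
    (fun x hx => sub_nonneg.2 (hmin _ ht1 x (hPD x hx))) hy hgy (fun x hx u hu => ?_)
    (fun h0 => ?_) (fun l hl => ?_) hsum ha
  · rw [estimate_add hT, ← mul_assoc, mul_one_div_cancel hT0.ne', one_mul,
      Finset.sum_add_distrib]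
  · have h1 := abs_sum_window_sub_le (g := fun s => f s x)
      (fun s hs => hdrift s hs x (hPD x hx)) T m
    rw [add_sub_cancel]
    refine h1.trans (mul_le_mul_of_nonneg_left ?_ hT0.le)
    linarith
  -- the range of the noise is shorter than `L`, so the intervals are extended to length `L`
  · have hind : iIndepFun (fun i : ℕ => N (m + 1 + i) x) μ := by
      have hinj : Function.Injective fun i : ℕ =>
          ((⟨m + 1 + i, by omega⟩, ⟨x, hx⟩) : {t : ℕ // 1 ≤ t} × {x // x ∈ P}) := by
        intro i j hij
        have h1 := congrArg (fun p : {t : ℕ // 1 ≤ t} × {x // x ∈ P} => (p.1 : ℕ)) hij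
        exact Nat.add_left_cancel h1
      exact hNindep.precomp hinj
    have hm : ∀ i : ℕ, Measurable (N (m + 1 + i) x) := fun i => hNmeas _ (by omega) x hx
    have hmean : ∀ i : ℕ, ∫ ω, N (m + 1 + i) x ω ∂μ = 0 := fun i => hNmean _ (by omega) x hx
    constructor
    · exact measureReal_le_sum_le_exp_of_mem_Icc hm hind hmean hL (A := A)
        (fun i => (hNb _ (by omega) x hx).mono fun ω hω => ⟨hω.1, by linarith [hω.2]⟩) hT hu
    · have h1 := measureReal_le_sum_le_exp_of_mem_Icc (X := fun i ω => -N (m + 1 + i) x ω)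
        (fun i => (hm i).neg) (hind.comp (fun _ r => -r) fun _ => measurable_neg)
        (fun i => by rw [integral_neg, hmean i, neg_zero]) hL (A := -B)
        (fun i => (hNb _ (by omega) x hx).mono fun ω hω =>
          ⟨neg_le_neg hω.2, by linarith [hω.1]⟩) hT hu
      simpa only [Finset.sum_neg_distrib] using h1
  · rw [hslice 0 h0, add_comm]
    exact hnl _ ht1 0 h0
  · rw [hslice l hl]
    linarith [hnl _ ht1 l hl]

end HittingSet

/-! ### Shells and hitting time -/

theorem theorem4 {d : ℕ} (hd : 1 ≤ d)
    {Ω : Type*} [MeasurableSpace Ω] (μ : MeasureTheory.Measure Ω)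
    [MeasureTheory.IsProbabilityMeasure μ]
    (D : Set (EuclideanSpace ℝ (Fin d))) (hD : IsCompact D)
    (f : ℕ → EuclideanSpace ℝ (Fin d) → ℝ)
    (Kt : ℕ → ℝ≥0) (K : ℝ≥0)
    (hLip : ∀ t, 1 ≤ t → LipschitzOnWith (Kt t) (f t) D)
    (hK : IsLUB (Kt '' Set.Ici 1) K)
    (hconv : ∀ t, 1 ≤ t → ConvexOn ℝ D (f t))
    (ε a : ℝ) (hε : 0 < ε) (ha : a ∈ Set.Ioc (0 : ℝ) 1)
    -- the query points
    (P : Finset (EuclideanSpace ℝ (Fin d))) (δ : ℝ) (hδ : 0 < δ)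
    (hδK : δ < 2 * ε / (7 * Real.sqrt d * K))
    (hgrid : IsUniformGrid δ D P)
    -- the noise
    (N : ℕ → EuclideanSpace ℝ (Fin d) → Ω → ℝ) (L : ℝ) (hL : 0 < L)
    (hNmeas : ∀ t, 1 ≤ t → ∀ x ∈ P, Measurable (N t x))
    (hNindep : ProbabilityTheory.iIndepFun
      (fun p : {t : ℕ // 1 ≤ t} × {x // x ∈ P} => N p.1 p.2) μ)
    (hNident : ∀ t, 1 ≤ t → ∀ x ∈ P, ∀ s, 1 ≤ s → ∀ y ∈ P,
      ProbabilityTheory.IdentDistrib (N t x) (N s y) μ μ)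
    (hNmean : ∀ t, 1 ≤ t → ∀ x ∈ P, ∫ ω, N t x ω ∂μ = 0)
    (hNbdd : ∃ A B : ℝ, B - A < L ∧
      ∀ t, 1 ≤ t → ∀ x ∈ P, ∀ᵐ ω ∂μ, N t x ω ∈ Set.Icc A B)
    -- the variation over time
    (hdrift : ∀ t, 1 ≤ t → ∀ x ∈ D,
      |f (t + 1) x - f t x| ≤ ε ^ 3 / (43 * L ^ 2 * Real.log ((P.card : ℝ) / a)))
    -- the level sets at height `M`, and the gradients
    (M : ℝ) (hM : 0 < M)
    (hsphere : ∀ t, 1 ≤ t → Nonempty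
      (levelSet D (f t) M ≃ₜ Metric.sphere (0 : EuclideanSpace ℝ (Fin d)) 1))
    (k : ℝ) (hk : 0 < k)
    (hgrad : ∀ t, 1 ≤ t → ∀ x ∈ interior D \ lowerContour D (f t) ε,
      DifferentiableAt ℝ (f t) x ∧ k ≤ ‖gradient (f t) x‖)
    -- the numbers `n_l`
    (lm : ℕ) (hlm : (lm : ℤ) ≤ ⌊M / ε⌋ - 3)
    (hden : ∀ l < lm, M - ((l : ℝ) + 4) * ε ≠ 0)
    (nl : ℕ → ℝ)
    (hnl : ∀ l < lm, nl l =
      shellRatio d K k M ε l / (1 + shellRatio d K k M ε l) * (P.card : ℝ) + 1)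
    (hnsum : ∑ l ∈ Finset.range (lm + 1), nl l = (P.card : ℝ)) :
    (∀ t, 1 ≤ t → ∀ l < lm,
      ((gridShell D P (f t) (((l : ℝ) + 1) * ε) (((l : ℝ) + 2) * ε)).card : ℝ) ≤ nl l) ∧
    ∃ Thit Tmin : ℕ,
      IsLeast (hittingSet μ D P f N ε a) Thit ∧
      IsLeast {T : ℕ | 1 ≤ T ∧ ∑ l ∈ Finset.range (lm + 1),
        nl l * Real.exp (-(2 * (T : ℝ) * ((l : ℝ) + 2 / 7) ^ 2 * ε ^ 2 / L ^ 2)) ≤ a} Tmin ∧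
      Thit ≤ Tmin := by
  classical
  have hlm' : ((lm : ℝ) + 3) * ε ≤ M := by
    have h1 : ((lm : ℤ) + 3) ≤ ⌊M / ε⌋ := by omega
    have h2 := Int.le_floor.1 h1
    push_cast at h2
    exact (le_div_iff₀ hε).1 h2
  have hlM : ∀ l < lm, ((l : ℝ) + 4) * ε < M := by
    intro l hl
    have h1 : (l : ℝ) + 1 ≤ lm := by exact_mod_cast hl
    exact lt_of_le_of_ne (by nlinarith) fun h => hden l hl (sub_eq_zero.2 h.symm)
  have hLip' : ∀ t, 1 ≤ t → LipschitzOnWith K (f t) D := fun t ht =>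
    (hLip t ht).weaken (hK.1 ⟨t, ht, rfl⟩)
  have hd0 : (0 : ℝ) < Real.sqrt d := Real.sqrt_pos.2 (by exact_mod_cast hd)
  -- `K = 0` would make the bound on `δ` the junk value `0`
  have hK0 : (0 : ℝ) < K := by
    refine lt_of_le_of_ne K.coe_nonneg fun h => ?_
    rw [← h, mul_zero, div_zero] at hδK
    exact lt_asymm hδ hδK
  have hη : K * (Real.sqrt d * (δ / 2)) < ε / 7 := by
    rw [lt_div_iff₀ (by positivity)] at hδK
    linarith
  have hsphere_ne : (Metric.sphere (0 : EuclideanSpace ℝ (Fin d)) 1).Nonempty := by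
    have : Nonempty (Fin d) := ⟨⟨0, hd⟩⟩
    exact NormedSpace.sphere_nonempty.2 zero_le_one
  have hlevel_ne : ∀ t, 1 ≤ t → ∃ z ∈ D, f t z - minValue D (f t) = M := by
    intro t ht
    obtain ⟨φ⟩ := hsphere t ht
    obtain ⟨s, hs⟩ := hsphere_ne
    exact ⟨φ.symm ⟨s, hs⟩, (φ.symm ⟨s, hs⟩).2⟩
  have hmin : ∀ t, 1 ≤ t → ∃ x ∈ D, f t x = minValue D (f t) ∧
      ∀ z ∈ D, minValue D (f t) ≤ f t z := by
    intro t ht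
    obtain ⟨z, hz, -⟩ := hlevel_ne t ht
    obtain ⟨x, hx, hxmin⟩ := hD.exists_isMinOn ⟨z, hz⟩ (hLip' t ht).continuousOn
    have hleast : IsLeast (f t '' D) (f t x) := ⟨⟨x, hx, rfl⟩, by
      rintro _ ⟨w, hw, rfl⟩
      exact hxmin hw⟩
    have h1 : minValue D (f t) = f t x := hleast.csInf_eq
    exact ⟨x, hx, h1.symm, fun w hw => by rw [h1]; exact hxmin hw⟩
  have hclose : ∀ t, 1 ≤ t → ∀ x ∈ D, ∃ y ∈ P, |f t y - f t x| ≤ ε / 7 ∧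
      ‖y - x‖ ≤ Real.sqrt d * δ / 2 := by
    intro t ht x hx
    obtain ⟨y, hy, hyx⟩ := hgrid.cover x hx
    refine ⟨y, hy, ?_, hyx⟩
    rw [← Real.dist_eq]
    refine ((hLip' t ht).dist_le_mul y (hgrid.subset y hy) x hx).trans ?_
    rw [dist_eq_norm]
    refine (mul_le_mul_of_nonneg_left hyx hK0.le).trans ?_
    linarith
  have hnear : ∀ t, 1 ≤ t → ∃ y ∈ P, f t y - minValue D (f t) ≤ ε / 7 := by
    intro t ht
    obtain ⟨x, hx, hxm, -⟩ := hmin t ht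
    obtain ⟨y, hy, h, -⟩ := hclose t ht x hx
    exact ⟨y, hy, by rw [← hxm]; exact le_of_abs_le h⟩
  have hcount : ∀ t, 1 ≤ t → ∀ l < lm,
      ((gridShell D P (f t) (((l : ℝ) + 1) * ε) (((l : ℝ) + 2) * ε)).card : ℝ) + 1 ≤ nl l := by
    intro t ht l hl
    rw [hnl l hl]
    have := card_gridShell_le hδ hd hD hgrid (hconv t ht) (hLip' t ht) hk hε hη.le
      (hsphere t ht) (hgrad t ht) (hlM l hl)
    linarith
  -- the minimum and the level `M ≥ 3 ε` are not attained near the same grid point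
  have hcard : (2 : ℝ) ≤ P.card := by
    obtain ⟨x, hx, hxm, -⟩ := hmin 1 le_rfl
    obtain ⟨z, hz, hzM⟩ := hlevel_ne 1 le_rfl
    obtain ⟨y, hy, hyx, -⟩ := hclose 1 le_rfl x hx
    obtain ⟨w, hw, hwz, -⟩ := hclose 1 le_rfl z hz
    have hyw : y ≠ w := by
      rintro rfl
      have h1 := (abs_le.1 hyx).2
      have h2 := (abs_le.1 hwz).1
      have h3 : (0 : ℝ) ≤ lm * ε := by positivity
      linarith
    exact_mod_cast Finset.one_lt_card.2 ⟨y, hy, w, hw, hyw⟩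
  have hnl_nonneg : ∀ l < lm, 0 ≤ nl l := fun l hl => by
    have h1 := hcount 1 le_rfl l hl
    have h2 : (0 : ℝ) ≤
      (gridShell D P (f 1) (((l : ℝ) + 1) * ε) (((l : ℝ) + 2) * ε)).card := Nat.cast_nonneg _
    linarith
  have hnl_le : ∀ l ≤ lm, nl l ≤ P.card + 1 := by
    intro l hl
    rcases hl.eq_or_lt with rfl | hlt
    · rw [Finset.sum_range_succ] at hnsum
      have := Finset.sum_nonneg fun i hi => hnl_nonneg i (Finset.mem_range.1 hi)
      linarith
    · rw [hnl l hlt]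
      have h1 : 0 ≤ shellRatio d K k M ε l := by
        have := mul_pos hk (sub_pos.2 (hlM l hlt))
        rw [shellRatio]; positivity
      have h2 : shellRatio d K k M ε l / (1 + shellRatio d K k M ε l) ≤ 1 := by
        rw [div_le_one (by linarith)]; linarith
      have h3 := mul_le_mul_of_nonneg_right h2 (Nat.cast_nonneg (α := ℝ) P.card)
      linarith
  refine ⟨fun t ht l hl => by linarith [hcount t ht l hl], ?_⟩
  obtain ⟨Tmin, hTmin⟩ := exists_isLeast_window (lm := lm) (nl := nl) hε hL ha.1
  have hTΔ : ((Tmin : ℝ) - 1) * (ε ^ 3 / (43 * L ^ 2 * Real.log ((P.card : ℝ) / a))) ≤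
      2 * ε / 7 := by
    by_contra! h
    -- otherwise the window `Tmin - 1` would do as well
    have hsum := sum_mul_exp_le_of_lt_drift hε hL ha.1 ha.2 hcard hnl_le h
    have hT2 : 2 ≤ Tmin := by
      by_contra! h2
      have h3 : Tmin = 1 := le_antisymm (by omega) hTmin.1.1
      rw [h3, Nat.cast_one, sub_self, zero_mul] at h
      linarith
    have hmem : Tmin - 1 ∈ {T : ℕ | 1 ≤ T ∧ ∑ l ∈ Finset.range (lm + 1),
        nl l * Real.exp (-(2 * (T : ℝ) * ((l : ℝ) + 2 / 7) ^ 2 * ε ^ 2 / L ^ 2)) ≤ a} := by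
      refine ⟨by omega, ?_⟩
      rw [Nat.cast_sub (by omega), Nat.cast_one]
      exact hsum
    have := hTmin.2 hmem
    omega
  have hhit : Tmin ∈ hittingSet μ D P f N ε a :=
    mem_hittingSet hε hL hgrid.subset
      (fun t ht x hx => by
        obtain ⟨-, -, -, h⟩ := hmin t ht
        exact h x hx)
      hnear hNmeas hNindep hNmean hNbdd hdrift hTmin.1.1 hTΔ hcount hnsum hTmin.1.2
  exact ⟨sInf (hittingSet μ D P f N ε a), Tmin, ⟨Nat.sInf_mem ⟨Tmin, hhit⟩, fun T hT =>
    Nat.sInf_le hT⟩, hTmin, Nat.sInf_le hhit⟩
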